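/- **Setting.** Let $q>2$ and $\sigma(z)=\max\{0,z\}^q$, $\ell(z)=\log(1+e^{-z})$. Fix a signal $\mathbf v\in\mathbb R^d$ and $\sigma_\xi,\sigma_0,\eta,\varepsilon>0$. The training data are $n$ i.i.d. points $(\mathbf x_i,y_i)$, $\mathbf x_i=[y_i\mathbf v,\boldsymbol\xi_i]$, where $y_i$ is uniform on $\{\pm1\}$ and, independently, $\boldsymbol\xi_i\sim\mathcal N\big(0,\sigma_\xi^2(\mathbf I-\mathbf v\mathbf v^\top/\|\mathbf v\|_2^2)\big)$. The network is $f(\mathbf W,\mathbf x)=F_{+1}(\mathbf W_{+1},\mathbf x)-F_{-1}(\mathbf W_{-1},\mathbf x)$ with $F_j(\mathbf W_j,\mathbf x)=\frac1m\sum_{r=1}^m[\sigma(\langle\mathbf w_{j,r},\mathbf x_1\rangle)+\sigma(\langle\mathbf w_{j,r},\mathbf x_2\rangle)]$, and $L_D(\mathbf W)=\frac1n\sum_{i=1}^n\ell(y_if(\mathbf W,\mathbf x_i))$. Noisy gradient descent starts from independent $\mathbf w_{j,r}^{(0)}\sim\mathcal N(0,\sigma_0^2\mathbf I)$ and iterates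 $$\mathbf w_{j,r}^{(t+1)}=\mathbf w_{j,r}^{(t)}-\eta\big(\nabla_{\mathbf w_{j,r}}L_D(\mathbf W^{(t)})+\mathbf z_{t+1}\big),\qquad \mathbf z_1,\mathbf z_2,\dots\ \text{i.i.d. }\mathcal N(0,\sigma_z^2\mathbf I),$$ the initialization, the data and the noise $(\mathbf z_s)$ being independent. Write $\|\boldsymbol\xi\|:=\sigma_\xi\sqrt d$ and $\mathrm{SNR}:=\|\mathbf v\|_2/(\sigma_\xi\sqrt d)$. The privacy noise is calibrated to the privacy budget $\varepsilon$ and to a total number $T$ of iterations: $$\sigma_z=c\,\frac{\sqrt T\,(\|\mathbf v\|_2+\|\boldsymbol\xi\|)}{mn\varepsilon},\qquad 0\le c\le A(\log d)^a,\qquad T\le A(\log d)^a\,\frac{mn\varepsilon\sigma_0}{\eta(\|\mathbf v\|_2+\|\boldsymbol\xi\|)},$$ where $A(\log d)^a$ is an arbitrary fixed polylogarithmic factor ($c$ contains the constant of the gradient sensitivity and the factor logarithmic in $1/\delta$). The coefficients $\Gamma_{j,r}^{(t)}\ge0$ and $\Phi_{j,r,i}^{(t)}$ are defined by the decomposition $$\mathbf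 w_{j,r}^{(t)}=\mathbf w_{j,r}^{(0)}+j\,\Gamma_{j,r}^{(t)}\frac{\mathbf v}{\|\mathbf v\|_2^2}+\sum_{i=1}^n\Phi_{j,r,i}^{(t)}\frac{\boldsymbol\xi_i}{\|\boldsymbol\xi_i\|_2^2}-\eta\sum_{s=1}^t\mathbf z_s .\tag{1}$$ **Theorem.** There are absolute constants $C_1,C_2>0$ such that for all $q>2$, $A$ and $a$ there are $K>0$ and $k\in\mathbb N$ for which the following holds. Put $\varkappa=K(\log d)^k$ and suppose that * $d\ge\varkappa\, m^{\max\{2,4/(q-2)\}}\,n^{\max\{4,(2q-2)/(q-2)\}}$, $\ n\ge\varkappa$, $\ m\ge\varkappa$; * $\eta\le\varkappa^{-1}\min\{\|\mathbf v\|_2^{-2},\|\boldsymbol\xi\|^{-2}\}$; * $\varkappa\,(n\varepsilon)^{-1/q}\|\mathbf v\|_2^{-1}\le\sigma_0\le\varkappa^{-1}\min\{\varepsilon^{-1/q}\|\boldsymbol\xi\|^{-1},\ n^{-1/(2q)}\|\mathbf v\|_2^{-1},\ (n\varepsilon)^{-(q+1)/q}\|\boldsymbol\xi\|^{-1}\}$;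 * $\min\{\mathrm{SNR}\cdot n\varepsilon,\ \mathrm{SNR}^q\cdot n\}\ge\varkappa$. Then there is $T_1\in\mathbb N$ with $$T_1\le C_1\,\frac{\log\!\big(1/(\sigma_0\|\mathbf v\|_2)\big)\,4^{q-1}\,m}{\eta\,q\,\sigma_0^{q-2}\,\|\mathbf v\|_2^{q}}$$ such that, with probability at least $1-1/d$, the coefficients in (1) exist for all $t\ge 0$ and are unique, and * $\max_r\Gamma_{j,r}^{(T_1)}\ge2$ for both $j\in\{\pm1\}$; * $|\Phi_{j,r,i}^{(t)}|\le C_2\,\sigma_0\sigma_\xi\sqrt d$ for all $j\in\{\pm1\}$, $r\in[m]$, $i\in[n]$ and $0\le t\le T_1$. -/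

import Mathlib

open MeasureTheory ProbabilityTheory

namespace NoisyCNN

noncomputable section

/-- Euclidean space of dimension `d`. -/
abbrev Vec (d : ℕ) : Type := EuclideanSpace ℝ (Fin d)

/-- The two classes `+1` and `-1` are `true` and `false`; `sgn` is the numerical value. -/
def sgn (j : Bool) : ℝ := if j then 1 else -1

/-- All filters `w_{j,r}`, where `j` is a class and `r` runs over the `m` filters of that class. -/
abbrev Weights (d m : ℕ) : Type := Bool → Fin m → Vec d

/-- A labelled data point: an input made of two patches, and a label. -/
abbrev DataPoint (d : ℕ) : Type := (Vec d × Vec d) × Bool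

/-- The polynomial ReLU `z ↦ max(0, z) ^ q`. -/
def polyReLU (q z : ℝ) : ℝ := (max 0 z) ^ q

/-- The logistic loss. -/
def logisticLoss (z : ℝ) : ℝ := Real.log (1 + Real.exp (-z))

/-- `F_j(W_j, x) = (1/m) ∑_r [σ(⟨w_{j,r}, x₁⟩) + σ(⟨w_{j,r}, x₂⟩)]`. -/
def branch {d m : ℕ} (q : ℝ) (w : Fin m → Vec d) (x : Vec d × Vec d) : ℝ :=
  (1 / (m : ℝ)) * ∑ r, (polyReLU q (inner ℝ (w r) x.1) + polyReLU q (inner ℝ (w r) x.2))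

/-- The two-layer network `f(W, x) = F_{+1}(W_{+1}, x) - F_{-1}(W_{-1}, x)`. -/
def network {d m : ℕ} (q : ℝ) (W : Weights d m) (x : Vec d × Vec d) : ℝ :=
  branch q (W true) x - branch q (W false) x

/-- The empirical risk `L_D(W) = (1/n) ∑_i ℓ(y_i f(W, x_i))`. -/
def empiricalRisk {d m n : ℕ} (q : ℝ) (D : Fin n → DataPoint d) (W : Weights d m) : ℝ :=
  (1 / (n : ℝ)) * ∑ i, logisticLoss (sgn (D i).2 * network q W (D i).1)

/-- The partial gradient of the empirical risk with respect to the filter `w_{j,r}`. -/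
def riskGradient {d m n : ℕ} (q : ℝ) (D : Fin n → DataPoint d) (W : Weights d m)
    (j : Bool) (r : Fin m) : Vec d :=
  gradient (fun w : Vec d =>
    empiricalRisk q D (Function.update W j (Function.update (W j) r w))) (W j r)

/-- Noisy gradient descent
`w_{j,r}^{(t+1)} = w_{j,r}^{(t)} - η (∇_{w_{j,r}} L_D(W^{(t)}) + z_{t+1})`. -/
def noisyGD {d m n : ℕ} (q η : ℝ) (D : Fin n → DataPoint d) (W₀ : Weights d m)
    (z : ℕ → Vec d) : ℕ → Weights d m
  | 0 => W₀
  | t + 1 => fun j r =>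
      noisyGD q η D W₀ z t j r
        - η • (riskGradient q D (noisyGD q η D W₀ z t) j r + z (t + 1))

/-- The covariance `σ² (I - v vᵀ / ‖v‖²)` of the data noise. -/
def dataNoiseCov {d : ℕ} (v : Vec d) (σ : ℝ) : Matrix (Fin d) (Fin d) ℝ :=
  σ ^ 2 • (1 - (‖v‖ ^ 2)⁻¹ • Matrix.vecMulVec v.ofLp v.ofLp)

/-- An outcome of all the randomness: the initialization, the labels, the data noise vectors, and
the sequence of privacy noise vectors (the vector of index `0` is never used). -/
abbrev Outcome (d m n : ℕ) : Type :=
  Weights d m × (Fin n → Bool) × (Fin n → Vec d) × (ℕ → Vec d)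

/-- The law of the randomness. All components are independent: every filter is `N(0, σ₀² I)` at
initialization, every label is uniform on the two classes, every data noise vector is
`N(0, σξ² (I - v vᵀ / ‖v‖²))`, and every privacy noise vector is `N(0, σz² I)`. -/
def outcomeLaw (d m n : ℕ) (v : Vec d) (σ₀ σξ σz : ℝ) : Measure (Outcome d m n) :=
  (Measure.pi fun _ : Bool => Measure.pi fun _ : Fin m =>
      multivariateGaussian 0 (σ₀ ^ 2 • (1 : Matrix (Fin d) (Fin d) ℝ))).prod
  ((Measure.pi fun _ : Fin n => (PMF.uniformOfFintype Bool).toMeasure).prod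
  ((Measure.pi fun _ : Fin n => multivariateGaussian 0 (dataNoiseCov v σξ)).prod
  (Measure.infinitePi fun _ : ℕ =>
      multivariateGaussian 0 (σz ^ 2 • (1 : Matrix (Fin d) (Fin d) ℝ)))))

/-- The training set: the `i`-th point has patches `y_i v`, `ξ_i` and label `y_i`. -/
def trainingSet {d m n : ℕ} (v : Vec d) (ω : Outcome d m n) : Fin n → DataPoint d :=
  fun i => ((sgn (ω.2.1 i) • v, ω.2.2.1 i), ω.2.1 i)

/-- The random iterates `W^{(t)}` of noisy gradient descent on the random training set. -/
def iterates {d m n : ℕ} (q η : ℝ) (v : Vec d) (ω : Outcome d m n) : ℕ → Weights d m :=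
  noisyGD q η (trainingSet v ω) ω.1 ω.2.2.2

/-- Candidate coefficients of the signal-noise decomposition: `Γ j r t` (signal learning) and
`Φ j r i t` (noise memorization). -/
structure Coefficients (m n : ℕ) where
  Γ : Bool → Fin m → ℕ → ℝ
  Φ : Bool → Fin m → Fin n → ℕ → ℝ

/-- `c` decomposes the iterates: `Γ ≥ 0` and, for all `t`, `j`, `r`,
`w_{j,r}^{(t)} = w_{j,r}^{(0)} + j Γ v / ‖v‖² + ∑_i Φ_i ξ_i / ‖ξ_i‖² - η ∑_{s=1}^t z_s`. -/
def IsDecomposition {d m n : ℕ} (q η : ℝ) (v : Vec d) (ω : Outcome d m n)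
    (c : Coefficients m n) : Prop :=
  ∀ (t : ℕ) (j : Bool) (r : Fin m),
    0 ≤ c.Γ j r t ∧
    iterates q η v ω t j r =
      ω.1 j r + (sgn j * c.Γ j r t / ‖v‖ ^ 2) • v
        + ∑ i, (c.Φ j r i t / ‖ω.2.2.1 i‖ ^ 2) • ω.2.2.1 i
        - η • ∑ s ∈ Finset.Icc 1 t, ω.2.2.2 s

/-- The typical size `σξ √d` of a data noise vector. -/
def noiseNorm (d : ℕ) (σξ : ℝ) : ℝ := σξ * √(d : ℝ)

/-- The signal-to-noise ratio `‖v‖ / (σξ √d)`. -/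
def SNR {d : ℕ} (v : Vec d) (σξ : ℝ) : ℝ := ‖v‖ / noiseNorm d σξ

/-- The standard deviation of the privacy noise: `T`-fold composition with privacy budget `ε` of
the Gaussian mechanism for gradients of sensitivity of order `(‖v‖ + σξ √d) / (n m)`.
The factor `c` collects the constant of the sensitivity and the factor logarithmic in `1/δ`. -/
def privacyNoiseStd {d : ℕ} (m n T : ℕ) (v : Vec d) (σξ ε c : ℝ) : ℝ :=
  c * √(T : ℝ) * (‖v‖ + noiseNorm d σξ) / (m * n * ε)

/-- The conditions of signal learning, where `κ` is the polylogarithmic factor that is hidden in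
the notations `Õ` and `Ω̃`. -/
structure SignalLearningCondition (q κ : ℝ) (d m n : ℕ) (v : Vec d) (ε η σ₀ σξ : ℝ) : Prop where
  dim : κ * ((m : ℝ) ^ max 2 (4 / (q - 2)) * (n : ℝ) ^ max 4 ((2 * q - 2) / (q - 2))) ≤ (d : ℝ)
  sample_size : κ ≤ (n : ℝ)
  width : κ ≤ (m : ℝ)
  step : η ≤ κ⁻¹ * min ((‖v‖ ^ 2)⁻¹) ((noiseNorm d σξ ^ 2)⁻¹)
  init_lower : κ * (((n : ℝ) * ε) ^ (-(1 / q)) * ‖v‖⁻¹) ≤ σ₀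
  init_upper : σ₀ ≤ κ⁻¹ *
    min (ε ^ (-(1 / q)) * (noiseNorm d σξ)⁻¹)
      (min ((n : ℝ) ^ (-(1 / (2 * q))) * ‖v‖⁻¹)
        (((n : ℝ) * ε) ^ (-((q + 1) / q)) * (noiseNorm d σξ)⁻¹))

/-- The order `log(1 / (σ₀ ‖v‖)) 4^{q-1} m / (η q σ₀^{q-2} ‖v‖^q)` of the length of the first
stage. -/
def firstStageLength {d : ℕ} (q : ℝ) (m : ℕ) (v : Vec d) (η σ₀ : ℝ) : ℝ :=
  Real.log (1 / (σ₀ * ‖v‖)) * (4 : ℝ) ^ (q - 1) * m /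
    (η * q * σ₀ ^ (q - 2) * ‖v‖ ^ q)

/-- The covariance of the data noise is a genuine one. -/
theorem dataNoiseCov_posSemidef {d : ℕ} (v : Vec d) (σ : ℝ) : (dataNoiseCov v σ).PosSemidef := by
  unfold dataNoiseCov
  refine Matrix.PosSemidef.smul ?_ (sq_nonneg σ)
  refine Matrix.PosSemidef.of_dotProduct_mulVec_nonneg ?_ fun x => ?_
  · ext i j
    simp [Matrix.vecMulVec_apply, Matrix.one_apply, mul_comm, eq_comm]
  · have h1 : dotProduct (star x) ((1 - (‖v‖ ^ 2)⁻¹ • Matrix.vecMulVec v.ofLp v.ofLp).mulVec x)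
        = ‖WithLp.toLp 2 x‖ ^ 2 - (‖v‖ ^ 2)⁻¹ * (inner ℝ v (WithLp.toLp 2 x)) ^ 2 := by
      have hx : (inner ℝ v (WithLp.toLp 2 x) : ℝ) = dotProduct v.ofLp x := by
        simp [PiLp.inner_apply, dotProduct, mul_comm]
      have hn : ‖WithLp.toLp 2 x‖ ^ 2 = dotProduct x x := by
        rw [EuclideanSpace.real_norm_sq_eq]
        simp [dotProduct, pow_two]
      rw [hx, hn, Matrix.sub_mulVec, Matrix.smul_mulVec, Matrix.vecMulVec_mulVec, dotProduct_sub,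
        dotProduct_smul, Matrix.one_mulVec, star_trivial]
      simp [dotProduct_comm x, pow_two]
    rw [h1]
    have h2 := abs_real_inner_le_norm v (WithLp.toLp 2 x)
    rcases eq_or_ne v 0 with rfl | hv
    · simp
    have hv' : 0 < ‖v‖ ^ 2 := by positivity
    have h3 : (inner ℝ v (WithLp.toLp 2 x)) ^ 2 ≤ ‖v‖ ^ 2 * ‖WithLp.toLp 2 x‖ ^ 2 := by
      rw [← sq_abs, ← mul_pow]
      gcongr
    rw [sub_nonneg, inv_mul_le_iff₀ hv']
    exact h3

end

end NoisyCNN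

open NoisyCNN

/-!
Two facts drive the proof.

*The parameter regime.* Write `x = σ₀ ‖v‖`, `y = σ₀ σξ √d` and `e = n ε`. The two-sided bound on the
initialization forces `κ ^ q ≤ x ^ q e` and `y κ² e ≤ x` (`regime_bounds`), so the
signal-to-noise ratio `x / y` is at least `κ² e`. Over `firstStageLength` many steps
this leaves the accumulated privacy noise below the initialization (`privacy_noise_small`) and the
accumulated gradient along the data noise below `y` (`noise_memorization_small`).

*The dynamics on a typical outcome.* The gradient of the empirical risk lies in the span of `v` and
of the `ξᵢ` (`riskGradient_eq`), so summing its components along these vectors gives the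
coefficients of the decomposition (`gradientCoefficients`); they are unique as soon as `v` and the
`ξᵢ` are linearly independent, which holds when the `ξᵢ` are orthogonal to `v` and nearly orthogonal
to one another (`isDecomposition_unique`). On such an outcome, if moreover the privacy noise stays
small throughout, the bound `|Φ| ≤ σ₀ σξ √d` propagates by induction in time, since every increment
is at most of order `y ^ (q - 1)` (`abs_Φ_le`). For the signal, suppose that all coefficients `Γ` of
a class stay below `2`. The network output then stays bounded, hence so does the slope of the loss
away from `0`. A filter whose initial component `u` along the signal is at least of order `x`, and
there is one among the many filters of the class, then satisfies `u ↦ u + α u ^ (q - 1)` up to the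
privacy noise. The potential `u ^ (-(q - 2))` drops by a multiple of `α` in each step
(`steps_mul_le_of_growth`), so that after a number of steps of order `x ^ (-(q - 2)) / α` there is
a contradiction (`two_le_iSup_Γ`). All constants depending on `q` that this costs are absorbed by the
logarithm `log (1 / x) ≥ log κ` in the length of the stage, which is why `C₁` and `C₂` can be
absolute (`first_stage_long`).

An outcome is typical with probability at least `1 - 1 / d` by a union bound over Gaussian tails,
Hoeffding's bound for the labels and the independence of the filters
(`exists_outcomeLaw_not_wellBehaved_le`). The privacy noise is controlled uniformly in time by Doob's
inequality for the exponential submartingale, which loses no factor in the number of steps.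
-/

namespace NoisyCNN

/-! ### The gradient of the empirical risk -/

/-- The derivative `q max(0, z)^{q-1}` of the polynomial ReLU. -/
noncomputable def polyReLUDeriv (q z : ℝ) : ℝ := q * (max 0 z) ^ (q - 1)

/-- The absolute value `1 / (1 + e^z)` of the derivative of the logistic loss. -/
noncomputable def lossSlope (z : ℝ) : ℝ := (1 + Real.exp z)⁻¹

lemma hasDerivAt_polyReLU {q : ℝ} (hq : 2 < q) (z : ℝ) :
    HasDerivAt (polyReLU q) (polyReLUDeriv q z) z := by
  unfold polyReLU polyReLUDeriv
  rcases lt_trichotomy z 0 with hz | rfl | hz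
  · rw [max_eq_left hz.le, Real.zero_rpow (by linarith), mul_zero]
    refine (hasDerivAt_const z (0 : ℝ)).congr_of_eventuallyEq ?_
    filter_upwards [Iio_mem_nhds hz] with y hy
    rw [max_eq_left (le_of_lt hy), Real.zero_rpow (by linarith)]
  · rw [max_self, Real.zero_rpow (by linarith), mul_zero, hasDerivAt_iff_isLittleO_nhds_zero]
    have h1 : (fun h : ℝ => (|h|) ^ q) =o[nhds 0] fun h => h := by
      have := (Real.hasDerivAt_rpow_const (x := 0) (p := q) (Or.inr (by linarith)))
      rw [hasDerivAt_iff_isLittleO_nhds_zero] at this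
      simp only [zero_add, Real.zero_rpow (show q ≠ 0 by linarith),
        Real.zero_rpow (show q - 1 ≠ 0 by linarith), sub_zero, mul_zero, smul_zero] at this
      have h2 := this.comp_tendsto (k := fun h : ℝ => |h|) (l' := nhds 0)
        (by simpa using (continuous_abs.tendsto (0 : ℝ)))
      exact h2.trans_isBigO (Asymptotics.isBigO_of_le _ fun x => by simp)
    refine Asymptotics.IsBigO.trans_isLittleO (Asymptotics.isBigO_of_le _ fun x => ?_) h1
    simp only [zero_add, max_self, Real.zero_rpow (show q ≠ 0 by linarith), smul_zero, sub_zero]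
    rw [Real.norm_of_nonneg (by positivity), Real.norm_of_nonneg (by positivity)]
    exact Real.rpow_le_rpow (by simp) (max_le (abs_nonneg _) (le_abs_self _)) (by linarith)
  · rw [max_eq_right hz.le]
    refine (Real.hasDerivAt_rpow_const (Or.inl hz.ne')).congr_of_eventuallyEq ?_
    filter_upwards [Ioi_mem_nhds hz] with y hy
    rw [max_eq_right (le_of_lt hy)]

lemma hasDerivAt_logisticLoss (z : ℝ) : HasDerivAt logisticLoss (-lossSlope z) z := by
  unfold logisticLoss lossSlope
  have h := (((hasDerivAt_neg z).exp).const_add 1).log (by positivity)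
  convert h using 1
  rw [Real.exp_neg]
  field_simp
  ring

lemma lossSlope_nonneg (z : ℝ) : 0 ≤ lossSlope z := by unfold lossSlope; positivity

lemma lossSlope_le_one (z : ℝ) : lossSlope z ≤ 1 := by
  unfold lossSlope
  exact inv_le_one_of_one_le₀ (by linarith [Real.exp_pos z])

lemma lossSlope_anti {a b : ℝ} (h : a ≤ b) : lossSlope b ≤ lossSlope a := by
  unfold lossSlope
  gcongr

lemma polyReLUDeriv_nonneg {q : ℝ} (hq : 2 < q) (z : ℝ) : 0 ≤ polyReLUDeriv q z := by
  unfold polyReLUDeriv; positivity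

lemma polyReLUDeriv_mono {q : ℝ} (hq : 2 < q) {a b : ℝ} (h : a ≤ b) :
    polyReLUDeriv q a ≤ polyReLUDeriv q b := by
  unfold polyReLUDeriv
  gcongr
  linarith

lemma sgn_mul_self (j : Bool) : sgn j * sgn j = 1 := by cases j <;> simp [sgn]

lemma abs_sgn (j : Bool) : |sgn j| = 1 := by cases j <;> simp [sgn]

lemma branch_update {d m : ℕ} (q : ℝ) (W : Fin m → Vec d) (r : Fin m) (x : Vec d × Vec d)
    (w : Vec d) :
    branch q (Function.update W r w) x = branch q W x
      - (1 / (m : ℝ)) * (polyReLU q (inner ℝ (W r) x.1) + polyReLU q (inner ℝ (W r) x.2))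
      + (1 / (m : ℝ)) * (polyReLU q (inner ℝ w x.1) + polyReLU q (inner ℝ w x.2)) := by
  unfold branch
  rw [← Finset.add_sum_erase _ _ (Finset.mem_univ r), ← Finset.add_sum_erase
    Finset.univ (fun r => polyReLU q (inner ℝ (W r) x.1) + polyReLU q (inner ℝ (W r) x.2))
    (Finset.mem_univ r)]
  have : ∑ k ∈ Finset.univ.erase r, (polyReLU q (inner ℝ (Function.update W r w k) x.1) +
      polyReLU q (inner ℝ (Function.update W r w k) x.2)) =
      ∑ k ∈ Finset.univ.erase r, (polyReLU q (inner ℝ (W k) x.1) +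
      polyReLU q (inner ℝ (W k) x.2)) :=
    Finset.sum_congr rfl fun k hk => by
      rw [Function.update_of_ne (Finset.ne_of_mem_erase hk)]
  rw [this, Function.update_self]
  ring

lemma network_update {d m : ℕ} (q : ℝ) (W : Weights d m) (j : Bool) (r : Fin m)
    (x : Vec d × Vec d) (w : Vec d) :
    network q (Function.update W j (Function.update (W j) r w)) x = network q W x
      - sgn j / m * (polyReLU q (inner ℝ (W j r) x.1) + polyReLU q (inner ℝ (W j r) x.2))
      + sgn j / m * (polyReLU q (inner ℝ w x.1) + polyReLU q (inner ℝ w x.2)) := by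
  unfold network
  cases j
  · rw [Function.update_self, Function.update_of_ne (by simp), branch_update]
    simp only [sgn]
    simp; ring
  · rw [Function.update_self, Function.update_of_ne (by simp), branch_update]
    simp only [sgn]
    simp; ring

lemma riskGradient_eq {d m n : ℕ} {q : ℝ} (hq : 2 < q) (D : Fin n → DataPoint d)
    (W : Weights d m) (j : Bool) (r : Fin m) :
    riskGradient q D W j r = -∑ i, (sgn j / (n * m) *
      (lossSlope (sgn (D i).2 * network q W (D i).1) * sgn (D i).2)) •
        (polyReLUDeriv q (inner ℝ (W j r) (D i).1.1) • (D i).1.1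
          + polyReLUDeriv q (inner ℝ (W j r) (D i).1.2) • (D i).1.2) := by
  have hin : ∀ x : Vec d, HasFDerivAt (fun w : Vec d => polyReLU q (inner ℝ w x))
      (polyReLUDeriv q (inner ℝ (W j r) x) • innerSL ℝ x) (W j r) := by
    intro x
    have h1 : HasFDerivAt (fun w : Vec d => inner ℝ w x) (innerSL ℝ x) (W j r) := by
      have := (innerSL ℝ x).hasFDerivAt (x := W j r)
      refine this.congr_of_eventuallyEq (Filter.Eventually.of_forall fun w => ?_)
      simp [real_inner_comm]
    exact (hasDerivAt_polyReLU hq _).comp_hasFDerivAt (W j r) h1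
  have hnet : ∀ x : Vec d × Vec d, HasFDerivAt
      (fun w => network q (Function.update W j (Function.update (W j) r w)) x)
      ((sgn j / m) • (polyReLUDeriv q (inner ℝ (W j r) x.1) • innerSL ℝ x.1
        + polyReLUDeriv q (inner ℝ (W j r) x.2) • innerSL ℝ x.2)) (W j r) := by
    intro x
    simp_rw [network_update]
    exact (((hin x.1).add (hin x.2)).const_mul (sgn j / m)).const_add _
  have hloss : ∀ i, HasFDerivAt (fun w => logisticLoss (sgn (D i).2 *
      network q (Function.update W j (Function.update (W j) r w)) (D i).1))
      ((-lossSlope (sgn (D i).2 * network q W (D i).1)) • (sgn (D i).2 •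
      ((sgn j / m) • (polyReLUDeriv q (inner ℝ (W j r) (D i).1.1) • innerSL ℝ (D i).1.1
        + polyReLUDeriv q (inner ℝ (W j r) (D i).1.2) • innerSL ℝ (D i).1.2)))) (W j r) := by
    intro i
    have h := hasDerivAt_logisticLoss (sgn (D i).2 *
      network q (Function.update W j (Function.update (W j) r (W j r))) (D i).1)
    have h2 := h.comp_hasFDerivAt (W j r) ((hnet (D i).1).const_mul (sgn (D i).2))
    simp only [Function.update_eq_self] at h2
    exact h2
  have hrisk := (HasFDerivAt.fun_sum (u := Finset.univ) fun i _ => hloss i).const_mul (1 / (n : ℝ))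
  unfold riskGradient
  refine HasGradientAt.gradient ?_
  rw [hasGradientAt_iff_hasFDerivAt]
  unfold empiricalRisk
  refine hrisk.congr_fderiv ?_
  ext w
  simp only [map_neg, map_sum, map_smul, map_add, neg_apply, sum_apply, smul_apply, add_apply,
    InnerProductSpace.toDual_apply_apply, innerSL_apply_apply, smul_eq_mul, Finset.mul_sum,
    ← Finset.sum_neg_distrib]
  refine Finset.sum_congr rfl fun i _ => ?_
  ring

/-! ### The coefficients of the signal-noise decomposition -/

section Coefficients

variable {d m n : ℕ} (q η : ℝ) (v : Vec d) (ω : Outcome d m n)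

/-- The absolute value of the loss derivative at the `i`-th training point at time `t`. -/
noncomputable def slopeAt (t : ℕ) (i : Fin n) : ℝ :=
  lossSlope (sgn (ω.2.1 i) * network q (iterates q η v ω t) (sgn (ω.2.1 i) • v, ω.2.2.1 i))

/-- The coefficients that accumulate, step by step, the two parts of the gradient: the component
along `v` and the components along the noise vectors. -/
noncomputable def gradientCoefficients : Coefficients m n where
  Γ j r t := ∑ s ∈ Finset.range t, η / (n * m) * ∑ i, slopeAt q η v ω s i *
    polyReLUDeriv q (inner ℝ (iterates q η v ω s j r) (sgn (ω.2.1 i) • v)) * ‖v‖ ^ 2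
  Φ j r i t := ∑ s ∈ Finset.range t, η * sgn j / (n * m) * (slopeAt q η v ω s i * sgn (ω.2.1 i) *
    polyReLUDeriv q (inner ℝ (iterates q η v ω s j r) (ω.2.2.1 i)) * ‖ω.2.2.1 i‖ ^ 2)

variable {q η v}

lemma slopeAt_nonneg (t : ℕ) (i : Fin n) : 0 ≤ slopeAt q η v ω t i := lossSlope_nonneg _

lemma slopeAt_le_one (t : ℕ) (i : Fin n) : slopeAt q η v ω t i ≤ 1 := lossSlope_le_one _

lemma gradientCoefficients_Γ_succ (j : Bool) (r : Fin m) (t : ℕ) :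
    (gradientCoefficients q η v ω).Γ j r (t + 1) = (gradientCoefficients q η v ω).Γ j r t
      + η / (n * m) * ∑ i, slopeAt q η v ω t i *
        polyReLUDeriv q (inner ℝ (iterates q η v ω t j r) (sgn (ω.2.1 i) • v)) * ‖v‖ ^ 2 :=
  Finset.sum_range_succ _ _

lemma gradientCoefficients_Φ_succ (j : Bool) (r : Fin m) (i : Fin n) (t : ℕ) :
    (gradientCoefficients q η v ω).Φ j r i (t + 1) = (gradientCoefficients q η v ω).Φ j r i t
      + η * sgn j / (n * m) * (slopeAt q η v ω t i * sgn (ω.2.1 i) *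
        polyReLUDeriv q (inner ℝ (iterates q η v ω t j r) (ω.2.2.1 i)) * ‖ω.2.2.1 i‖ ^ 2) :=
  Finset.sum_range_succ _ _

lemma gradientCoefficients_Γ_le_succ (hq : 2 < q) (hη : 0 < η) (j : Bool) (r : Fin m) (t : ℕ) :
    (gradientCoefficients q η v ω).Γ j r t ≤ (gradientCoefficients q η v ω).Γ j r (t + 1) := by
  rw [gradientCoefficients_Γ_succ]
  have : 0 ≤ η / (n * m) * ∑ i, slopeAt q η v ω t i *
      polyReLUDeriv q (inner ℝ (iterates q η v ω t j r) (sgn (ω.2.1 i) • v)) * ‖v‖ ^ 2 := by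
    refine mul_nonneg (by positivity) (Finset.sum_nonneg fun i _ => ?_)
    exact mul_nonneg (mul_nonneg (slopeAt_nonneg ω t i) (polyReLUDeriv_nonneg hq _))
      (by positivity)
  linarith

lemma gradientCoefficients_Γ_nonneg (hq : 2 < q) (hη : 0 < η) (j : Bool) (r : Fin m) (t : ℕ) :
    0 ≤ (gradientCoefficients q η v ω).Γ j r t := by
  have h := monotone_nat_of_le_succ (gradientCoefficients_Γ_le_succ (v := v) ω hq hη j r)
    (Nat.zero_le t)
  simpa [gradientCoefficients] using h

/-- The gradient is a combination of `v` and the noise vectors, so its contributions can be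
collected along these directions. -/
theorem isDecomposition_gradientCoefficients (hq : 2 < q) (hη : 0 < η) (hv : v ≠ 0) :
    IsDecomposition q η v ω (gradientCoefficients q η v ω) := by
  intro t j r
  refine ⟨gradientCoefficients_Γ_nonneg ω hq hη j r t, ?_⟩
  induction t with
  | zero => simp [gradientCoefficients, iterates, noisyGD]
  | succ t ih =>
    have hstep : iterates q η v ω (t + 1) j r = iterates q η v ω t j r
        - η • (riskGradient q (trainingSet v ω) (iterates q η v ω t) j r + ω.2.2.2 (t + 1)) := rfl
    rw [hstep, riskGradient_eq hq]
    set W := iterates q η v ω t with hW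
    rw [gradientCoefficients_Γ_succ, Finset.sum_Icc_succ_top (by omega)]
    simp_rw [gradientCoefficients_Φ_succ]
    have hv2 : ‖v‖ ^ 2 ≠ 0 := by positivity
    have hξ : ∀ (a : ℝ) (i : Fin n), (a * ‖ω.2.2.1 i‖ ^ 2 / ‖ω.2.2.1 i‖ ^ 2) • ω.2.2.1 i
        = a • ω.2.2.1 i := by
      intro a i
      by_cases h : ω.2.2.1 i = 0
      · simp [h]
      · rw [mul_div_cancel_right₀ _ (by positivity)]
    have h1 : (sgn j * ((gradientCoefficients q η v ω).Γ j r t + η / (n * m) * ∑ i,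
        slopeAt q η v ω t i * polyReLUDeriv q (inner ℝ (W j r) (sgn (ω.2.1 i) • v)) * ‖v‖ ^ 2)
          / ‖v‖ ^ 2) • v = (sgn j * (gradientCoefficients q η v ω).Γ j r t / ‖v‖ ^ 2) • v
        + η • ∑ i, (sgn j / (n * m) * (slopeAt q η v ω t i * sgn (ω.2.1 i))) •
          polyReLUDeriv q (inner ℝ (W j r) (sgn (ω.2.1 i) • v)) • sgn (ω.2.1 i) • v := by
      rw [← Finset.sum_mul, ← mul_assoc, mul_add, add_div, ← mul_assoc, ← mul_assoc,
        mul_div_cancel_right₀ _ hv2, add_smul]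
      congr 1
      simp_rw [smul_smul]
      rw [← Finset.sum_smul, smul_smul]
      congr 1
      rw [Finset.mul_sum, Finset.mul_sum]
      refine Finset.sum_congr rfl fun i _ => ?_
      linear_combination (-(η * sgn j / (n * m) * slopeAt q η v ω t i *
        polyReLUDeriv q (inner ℝ (W j r) (sgn (ω.2.1 i) • v)))) * sgn_mul_self (ω.2.1 i)
    have h2 : ∑ i, (((gradientCoefficients q η v ω).Φ j r i t + η * sgn j / (n * m) *
        (slopeAt q η v ω t i * sgn (ω.2.1 i) * polyReLUDeriv q (inner ℝ (W j r) (ω.2.2.1 i))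
          * ‖ω.2.2.1 i‖ ^ 2)) / ‖ω.2.2.1 i‖ ^ 2) • ω.2.2.1 i
        = ∑ i, ((gradientCoefficients q η v ω).Φ j r i t / ‖ω.2.2.1 i‖ ^ 2) • ω.2.2.1 i
        + η • ∑ i, (sgn j / (n * m) * (slopeAt q η v ω t i * sgn (ω.2.1 i))) •
          polyReLUDeriv q (inner ℝ (W j r) (ω.2.2.1 i)) • ω.2.2.1 i := by
      rw [Finset.smul_sum, ← Finset.sum_add_distrib]
      refine Finset.sum_congr rfl fun i _ => ?_
      rw [← mul_assoc, add_div, add_smul, hξ, smul_smul, smul_smul]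
      congr 2
      ring
    rw [h1, h2, ih]
    simp only [trainingSet]
    simp_rw [smul_add, Finset.sum_add_distrib]
    simp only [slopeAt, ← hW]
    simp only [smul_add, smul_neg]
    abel

end Coefficients

/-! ### Typical outcomes -/

/-- The properties of an outcome on which the deterministic analysis rests: `L` is a logarithmic
factor, `δ` bounds the normalized data noise from below, and `ρ` bounds the accumulated privacy
noise `η ∑_{s ≤ t} z_s` along each relevant direction for all `t ≤ N`. -/
structure WellBehaved {d m n : ℕ} (L δ ρ η σ₀ σξ : ℝ) (N : ℕ) (v : Vec d)
    (ω : Outcome d m n) : Prop where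
  orthogonal : ∀ i, inner ℝ (ω.2.2.1 i) v = 0
  noise_lower : ∀ i, δ * noiseNorm d σξ ≤ ‖ω.2.2.1 i‖
  noise_upper : ∀ i, ‖ω.2.2.1 i‖ ≤ L * noiseNorm d σξ
  cross : ∀ i i', i ≠ i' → |inner ℝ (ω.2.2.1 i) (ω.2.2.1 i')| ≤ L * σξ * ‖ω.2.2.1 i'‖
  init_noise : ∀ j r i, |inner ℝ (ω.1 j r) (ω.2.2.1 i)| ≤ L * σ₀ * ‖ω.2.2.1 i‖
  init_signal : ∀ j r, |inner ℝ (ω.1 j r) v| ≤ L * σ₀ * ‖v‖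
  init_large : ∀ j, ∃ r, σ₀ * ‖v‖ ≤ sgn j * inner ℝ (ω.1 j r) v
  privacy_signal : ∀ t ≤ N, |η * inner ℝ (∑ s ∈ Finset.Icc 1 t, ω.2.2.2 s) v| ≤ ρ * ‖v‖
  privacy_noise : ∀ t ≤ N, ∀ i,
    |η * inner ℝ (∑ s ∈ Finset.Icc 1 t, ω.2.2.2 s) (ω.2.2.1 i)| ≤ ρ * ‖ω.2.2.1 i‖
  labels : ∀ j, (n : ℝ) / 4 ≤ (Finset.univ.filter fun i => ω.2.1 i = j).card

section Deterministic

variable {d m n N : ℕ} {q L δ ρ η σ₀ σξ : ℝ} {v : Vec d} {ω : Outcome d m n}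

/-- A combination of almost orthogonal noise vectors has nearly the coefficient of `ξ_k` as its
normalized inner product with `ξ_k`. -/
lemma abs_sum_inner_le (hω : WellBehaved L δ ρ η σ₀ σξ N v ω) (hLσ : 0 ≤ L * σξ)
    (hcross : n * (L * σξ) < δ * noiseNorm d σξ) {P : ℝ} (hP : 0 ≤ P) {a : Fin n → ℝ}
    (ha : ∀ i, |a i| ≤ P) (k : Fin n) :
    |∑ i ∈ Finset.univ.erase k,
      a i / ‖ω.2.2.1 i‖ ^ 2 * inner ℝ (ω.2.2.1 i) (ω.2.2.1 k)|
      ≤ n * (L * σξ) / (δ * noiseNorm d σξ) * P := by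
  have hX : 0 < δ * noiseNorm d σξ := lt_of_le_of_lt (by positivity) hcross
  refine (Finset.abs_sum_le_sum_abs _ _).trans ?_
  have hterm : ∀ i ∈ Finset.univ.erase k,
      |a i / ‖ω.2.2.1 i‖ ^ 2 * inner ℝ (ω.2.2.1 i) (ω.2.2.1 k)|
        ≤ L * σξ / (δ * noiseNorm d σξ) * P := by
    intro i hi
    have hpos : 0 < ‖ω.2.2.1 i‖ := hX.trans_le (hω.noise_lower i)
    have h1 := hω.cross k i (Finset.ne_of_mem_erase hi).symm
    rw [abs_mul, abs_div, abs_of_nonneg (sq_nonneg ‖ω.2.2.1 i‖), real_inner_comm]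
    calc |a i| / ‖ω.2.2.1 i‖ ^ 2 * |inner ℝ (ω.2.2.1 k) (ω.2.2.1 i)|
        ≤ P / ‖ω.2.2.1 i‖ ^ 2 * (L * σξ * ‖ω.2.2.1 i‖) := by
          gcongr
          exact ha i
      _ = L * σξ / ‖ω.2.2.1 i‖ * P := by field_simp
      _ ≤ _ := by
          gcongr
          exact hω.noise_lower i
  refine (Finset.sum_le_sum hterm).trans ?_
  rw [Finset.sum_const, nsmul_eq_mul]
  have hcard : ((Finset.univ.erase k).card : ℝ) ≤ n := by
    have := Finset.card_le_univ (Finset.univ.erase k)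
    rw [Fintype.card_fin] at this
    exact_mod_cast this
  calc _ ≤ (n : ℝ) * (L * σξ / (δ * noiseNorm d σξ) * P) := by gcongr
    _ = _ := by ring

lemma sum_inner_eq (a : Fin n → ℝ) (ξ : Fin n → Vec d) (k : Fin n) (hk : ξ k ≠ 0) :
    inner ℝ (∑ i, (a i / ‖ξ i‖ ^ 2) • ξ i) (ξ k)
      = a k + ∑ i ∈ Finset.univ.erase k, a i / ‖ξ i‖ ^ 2 * inner ℝ (ξ i) (ξ k) := by
  rw [sum_inner, ← Finset.add_sum_erase _ _ (Finset.mem_univ k)]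
  simp_rw [real_inner_smul_left, real_inner_self_eq_norm_sq]
  have : ‖ξ k‖ ≠ 0 := norm_ne_zero_iff.2 hk
  congr 1
  field_simp

lemma noise_ne_zero (hω : WellBehaved L δ ρ η σ₀ σξ N v ω) (hX : 0 < δ * noiseNorm d σξ)
    (i : Fin n) : ω.2.2.1 i ≠ 0 :=
  norm_pos_iff.1 (hX.trans_le (hω.noise_lower i))

/-- Almost orthogonal noise vectors are linearly independent: at a coefficient of maximal modulus
the cross terms cannot cancel it. -/
lemma coeff_eq_zero_of_sum_eq_zero (hω : WellBehaved L δ ρ η σ₀ σξ N v ω) (hLσ : 0 ≤ L * σξ)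
    (hcross : n * (L * σξ) < δ * noiseNorm d σξ) (a : Fin n → ℝ)
    (h : ∑ i, (a i / ‖ω.2.2.1 i‖ ^ 2) • ω.2.2.1 i = 0) (i : Fin n) : a i = 0 := by
  have hX : 0 < δ * noiseNorm d σξ := lt_of_le_of_lt (by positivity) hcross
  obtain ⟨k, -, hk⟩ := Finset.exists_max_image Finset.univ (fun i => |a i|) ⟨i, Finset.mem_univ _⟩
  have h1 := sum_inner_eq a ω.2.2.1 k (noise_ne_zero hω hX k)
  rw [h, inner_zero_left] at h1
  have h2 := abs_sum_inner_le hω hLσ hcross (abs_nonneg (a k))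
    (fun i => hk i (Finset.mem_univ _)) k
  rw [show (∑ i ∈ Finset.univ.erase k, a i / ‖ω.2.2.1 i‖ ^ 2 *
    inner ℝ (ω.2.2.1 i) (ω.2.2.1 k)) = -a k by linarith, abs_neg] at h2
  have h3 : n * (L * σξ) / (δ * noiseNorm d σξ) < 1 := (div_lt_one hX).2 hcross
  have h4 : |a k| = 0 := by
    by_contra hne
    have := lt_of_le_of_ne (abs_nonneg (a k)) (Ne.symm hne)
    nlinarith
  have h5 := hk i (Finset.mem_univ _)
  rw [h4] at h5
  exact abs_eq_zero.1 (le_antisymm h5 (abs_nonneg _))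

/-- On a typical outcome the coefficients of the decomposition are unique. -/
lemma isDecomposition_unique (hω : WellBehaved L δ ρ η σ₀ σξ N v ω) (hLσ : 0 ≤ L * σξ)
    (hcross : n * (L * σξ) < δ * noiseNorm d σξ) (hv : v ≠ 0) {c c' : Coefficients m n}
    (hc : IsDecomposition q η v ω c) (hc' : IsDecomposition q η v ω c') : c' = c := by
  have hv0 : ‖v‖ ≠ 0 := norm_ne_zero_iff.2 hv
  have key : ∀ t j r, c'.Γ j r t = c.Γ j r t ∧ ∀ i, c'.Φ j r i t = c.Φ j r i t := by
    intro t j r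
    have h : (sgn j * c'.Γ j r t / ‖v‖ ^ 2) • v
        + ∑ i, (c'.Φ j r i t / ‖ω.2.2.1 i‖ ^ 2) • ω.2.2.1 i
        = (sgn j * c.Γ j r t / ‖v‖ ^ 2) • v
        + ∑ i, (c.Φ j r i t / ‖ω.2.2.1 i‖ ^ 2) • ω.2.2.1 i := by
      have h1 := (hc t j r).2
      rw [(hc' t j r).2] at h1
      have h2 := sub_left_injective h1
      rw [add_assoc, add_assoc] at h2
      exact add_left_cancel h2
    have horth : ∀ a : Fin n → ℝ, inner ℝ (∑ i, (a i / ‖ω.2.2.1 i‖ ^ 2) • ω.2.2.1 i) v = 0 := by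
      intro a
      rw [sum_inner]
      exact Finset.sum_eq_zero fun i _ => by rw [real_inner_smul_left, hω.orthogonal, mul_zero]
    have hΓ : c'.Γ j r t = c.Γ j r t := by
      have h3 := congrArg (fun x => inner ℝ x v) h
      simp only [inner_add_left, horth, real_inner_smul_left, real_inner_self_eq_norm_sq,
        add_zero] at h3
      field_simp at h3
      have h4 := congrArg (fun x => sgn j * x) h3
      simpa only [← mul_assoc, sgn_mul_self, one_mul] using h4
    refine ⟨hΓ, fun i => ?_⟩
    rw [hΓ] at h
    have h5 := add_left_cancel h
    have h6 := coeff_eq_zero_of_sum_eq_zero hω hLσ hcross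
      (fun i => c'.Φ j r i t - c.Φ j r i t) (by
        simp_rw [sub_div, sub_smul, Finset.sum_sub_distrib, h5, sub_self]) i
    linarith
  cases c
  cases c'
  simp only [Coefficients.mk.injEq]
  exact ⟨by ext j r t; exact (key t j r).1, by ext j r i t; exact (key t j r).2 i⟩

lemma inner_iterates_signal (hω : WellBehaved L δ ρ η σ₀ σξ N v ω) (hv : v ≠ 0)
    {c : Coefficients m n} (hc : IsDecomposition q η v ω c) (t : ℕ) (j : Bool) (r : Fin m) :
    inner ℝ (iterates q η v ω t j r) v = inner ℝ (ω.1 j r) v + sgn j * c.Γ j r t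
      - η * inner ℝ (∑ s ∈ Finset.Icc 1 t, ω.2.2.2 s) v := by
  have hv0 : ‖v‖ ≠ 0 := norm_ne_zero_iff.2 hv
  rw [(hc t j r).2, inner_sub_left, inner_add_left, inner_add_left, sum_inner,
    real_inner_smul_left, real_inner_smul_left, real_inner_self_eq_norm_sq,
    Finset.sum_eq_zero fun i _ => by rw [real_inner_smul_left, hω.orthogonal, mul_zero]]
  field_simp
  ring

lemma inner_iterates_noise (hω : WellBehaved L δ ρ η σ₀ σξ N v ω)
    (hX : 0 < δ * noiseNorm d σξ)
    {c : Coefficients m n} (hc : IsDecomposition q η v ω c) (t : ℕ) (j : Bool) (r : Fin m)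
    (k : Fin n) :
    inner ℝ (iterates q η v ω t j r) (ω.2.2.1 k) = inner ℝ (ω.1 j r) (ω.2.2.1 k)
      + (c.Φ j r k t + ∑ i ∈ Finset.univ.erase k,
        c.Φ j r i t / ‖ω.2.2.1 i‖ ^ 2 * inner ℝ (ω.2.2.1 i) (ω.2.2.1 k))
      - η * inner ℝ (∑ s ∈ Finset.Icc 1 t, ω.2.2.2 s) (ω.2.2.1 k) := by
  have hk := noise_ne_zero hω hX k
  rw [(hc t j r).2, inner_sub_left, inner_add_left, inner_add_left,
    sum_inner_eq (fun i => c.Φ j r i t) ω.2.2.1 k hk, real_inner_smul_left, real_inner_smul_left,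
    real_inner_comm (ω.2.2.1 k) v, hω.orthogonal]
  ring

/-! ### Noise memorization -/

lemma inner_iterates_noise_le (hω : WellBehaved L δ ρ η σ₀ σξ N v ω)
    (hL : 1 ≤ L) (hσ₀ : 0 < σ₀) (hσξ : 0 < σξ)
    (hcross : n * (L * σξ) < δ * noiseNorm d σξ) (hρ : ρ ≤ σ₀ / 2)
    {c : Coefficients m n} (hc : IsDecomposition q η v ω c) {t : ℕ} (ht : t ≤ N) (j : Bool)
    (r : Fin m) (hΦ : ∀ i, |c.Φ j r i t| ≤ σ₀ * noiseNorm d σξ) (k : Fin n) :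
    inner ℝ (iterates q η v ω t j r) (ω.2.2.1 k) ≤ 4 * L ^ 2 * (σ₀ * noiseNorm d σξ) := by
  have hX : 0 < δ * noiseNorm d σξ := lt_of_le_of_lt (by positivity) hcross
  have hX0 : 0 ≤ noiseNorm d σξ := by unfold noiseNorm; positivity
  rw [inner_iterates_noise hω hX hc]
  have h1 := (le_abs_self _).trans (hω.init_noise j r k)
  have h2 := (neg_abs_le _).trans' (neg_le_neg (hω.privacy_noise t ht k))
  have h3 := (le_abs_self _).trans (hΦ k)
  have h4 := (le_abs_self _).trans
    (abs_sum_inner_le hω (by positivity) hcross (by positivity) hΦ k)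
  have h5 : n * (L * σξ) / (δ * noiseNorm d σξ) * (σ₀ * noiseNorm d σξ)
      ≤ 1 * (σ₀ * noiseNorm d σξ) := by
    gcongr
    exact ((div_lt_one hX).2 hcross).le
  have h6 : L * σ₀ * ‖ω.2.2.1 k‖ ≤ L * σ₀ * (L * noiseNorm d σξ) := by
    gcongr; exact hω.noise_upper k
  have h7 : ρ * ‖ω.2.2.1 k‖ ≤ σ₀ / 2 * (L * noiseNorm d σξ) := by
    gcongr; exact hω.noise_upper k
  have h8 : 0 ≤ σ₀ * noiseNorm d σξ := by positivity
  nlinarith [mul_nonneg h8 (show 0 ≤ L - 1 by linarith),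
    mul_nonneg h8 (show 0 ≤ (L - 1) * L from mul_nonneg (by linarith) (by linarith))]

/-- The noise coefficients stay below their initial order: as long as they do, every step changes
them by a tiny amount, because the derivative of the activation is of order
`(σ₀ ‖ξ‖)^{q-1}`. -/
lemma abs_Φ_le (hω : WellBehaved L δ ρ η σ₀ σξ N v ω) (hq : 2 < q) (hη : 0 < η) (hv : v ≠ 0)
    (hL : 1 ≤ L) (hσ₀ : 0 < σ₀) (hσξ : 0 < σξ)
    (hcross : n * (L * σξ) < δ * noiseNorm d σξ) (hρ : ρ ≤ σ₀ / 2)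
    (hsum : N * (η / (n * m) * (q * (4 * L ^ 2 * (σ₀ * noiseNorm d σξ)) ^ (q - 1)
      * (L * noiseNorm d σξ) ^ 2)) ≤ σ₀ * noiseNorm d σξ)
    {t : ℕ} (ht : t ≤ N) (j : Bool) (r : Fin m) (i : Fin n) :
    |(gradientCoefficients q η v ω).Φ j r i t| ≤ σ₀ * noiseNorm d σξ := by
  have hX0 : 0 ≤ noiseNorm d σξ := by unfold noiseNorm; positivity
  set a := η / (n * m) * (q * (4 * L ^ 2 * (σ₀ * noiseNorm d σξ)) ^ (q - 1)
      * (L * noiseNorm d σξ) ^ 2) with ha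
  have ha0 : 0 ≤ a := by positivity
  have hc := isDecomposition_gradientCoefficients ω hq hη hv
  have hle : ∀ t : ℕ, t ≤ N → t * a ≤ σ₀ * noiseNorm d σξ := fun t ht =>
    (mul_le_mul_of_nonneg_right (by exact_mod_cast ht) ha0).trans hsum
  suffices h : ∀ i, |(gradientCoefficients q η v ω).Φ j r i t| ≤ t * a from (h i).trans (hle t ht)
  induction t with
  | zero => intro i; simp [gradientCoefficients]
  | succ t ih =>
    intro i
    have ih' := ih (by omega)
    rw [gradientCoefficients_Φ_succ]
    refine (abs_add_le _ _).trans ?_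
    push_cast
    rw [add_mul, one_mul]
    refine add_le_add (ih' i) ?_
    have hin := inner_iterates_noise_le hω hL hσ₀ hσξ hcross hρ hc (t := t) (by omega) j r
      (fun i => (ih' i).trans (hle t (by omega))) i
    have h0 : (0 : ℝ) ≤ 4 * L ^ 2 * (σ₀ * noiseNorm d σξ) := by positivity
    have hder := polyReLUDeriv_mono hq hin
    have hder0 := polyReLUDeriv_nonneg hq (inner ℝ (iterates q η v ω t j r) (ω.2.2.1 i))
    simp only [abs_mul, abs_div, abs_sgn, abs_of_pos hη, abs_of_nonneg (slopeAt_nonneg ω t i),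
      abs_of_nonneg hder0, abs_pow, abs_norm, Nat.abs_cast, mul_one]
    rw [ha]
    refine mul_le_mul_of_nonneg_left (mul_le_mul ?_ ?_ (sq_nonneg _) (by positivity))
      (by positivity)
    · calc _ ≤ 1 * polyReLUDeriv q (4 * L ^ 2 * (σ₀ * noiseNorm d σξ)) := by
            gcongr
            exact slopeAt_le_one ω t i
        _ = _ := by rw [one_mul, polyReLUDeriv, max_eq_right h0]
    · gcongr
      exact hω.noise_upper i

end Deterministic

/-! ### Signal learning -/

/-- Along `u ↦ u + α u^{p+1}` the potential `u^{-p}` drops by a fixed amount at every step, so the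
number of steps before `u` leaves a bounded region is at most of order `u₀^{-p} / α`. -/
lemma steps_mul_le_of_growth {p α U u₀ : ℝ} (hp : 0 < p) (hα : 0 ≤ α) (hu₀ : 0 < u₀) {u : ℕ → ℝ}
    {N : ℕ} (h0 : u₀ ≤ u 0) (hU : α * U ^ p ≤ 1) (hle : ∀ t < N, u t ≤ U)
    (hstep : ∀ t < N, u t + α * u t ^ (p + 1) ≤ u (t + 1)) :
    N * (α * (p / (p + 2))) ≤ u₀ ^ (-p) := by
  have key : ∀ t ≤ N, 0 < u t ∧ u t ^ (-p) ≤ u₀ ^ (-p) - t * (α * (p / (p + 2))) := by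
    intro t ht
    induction t with
    | zero =>
      refine ⟨hu₀.trans_le h0, ?_⟩
      simpa using Real.rpow_le_rpow_of_nonpos hu₀ h0 (by linarith)
    | succ t ih =>
      obtain ⟨hpos, hφ⟩ := ih (by omega)
      set x := α * u t ^ p with hx
      have hx0 : 0 ≤ x := by positivity
      have hx1 : x ≤ 1 := by
        refine le_trans ?_ hU
        have := hle t (by omega)
        rw [hx]; gcongr
      have hs : u t * (1 + x) ≤ u (t + 1) := by
        refine le_trans (le_of_eq ?_) (hstep t (by omega))
        rw [hx, Real.rpow_add_one hpos.ne']; ring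
      have hpos' : 0 < u t * (1 + x) := by positivity
      refine ⟨hpos'.trans_le hs, ?_⟩
      -- `(1 + x)^p ≥ 1 + p log (1 + x) ≥ 1 + p x / 2` on `[0, 1]`
      have hlog : x / 2 ≤ Real.log (1 + x) := by
        refine le_trans ?_ (Real.one_sub_inv_le_log_of_pos (by linarith))
        rw [show 1 - (1 + x)⁻¹ = x / (1 + x) by field_simp; ring]
        gcongr
        linarith
      have hpow : 1 + p * (x / 2) ≤ (1 + x) ^ p := by
        rw [Real.rpow_def_of_pos (by linarith), mul_comm (Real.log _)]
        have := Real.add_one_le_exp (p * Real.log (1 + x))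
        nlinarith
      have hinv : (1 + x) ^ (-p) ≤ 1 - x * (p / (p + 2)) := by
        rw [Real.rpow_neg (by linarith)]
        refine (inv_anti₀ (by positivity) hpow).trans ?_
        rw [inv_le_iff_one_le_mul₀ (by positivity)]
        have : (1 - x * (p / (p + 2))) * (1 + p * (x / 2)) - 1
          = x * (p / (p + 2)) * (p / 2) * (1 - x) := by field_simp; ring
        have h2 : 0 ≤ x * (p / (p + 2)) * (p / 2) * (1 - x) :=
          mul_nonneg (by positivity) (by linarith)
        linarith
      have hmul : u t ^ (-p) * x = α := by
        rw [hx, mul_left_comm, ← Real.rpow_add hpos]; simp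
      calc u (t + 1) ^ (-p) ≤ (u t * (1 + x)) ^ (-p) :=
            Real.rpow_le_rpow_of_nonpos hpos' hs (by linarith)
        _ = u t ^ (-p) * (1 + x) ^ (-p) := Real.mul_rpow hpos.le (by linarith)
        _ ≤ u t ^ (-p) * (1 - x * (p / (p + 2))) := by gcongr
        _ = u t ^ (-p) - α * (p / (p + 2)) := by rw [mul_sub, ← mul_assoc, hmul]; ring
        _ ≤ _ := by push_cast; linarith
  obtain ⟨hpos, h⟩ := key N le_rfl
  have : 0 ≤ u N ^ (-p) := by positivity
  linarith

section Deterministic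

variable {d m n N : ℕ} {q L δ ρ η σ₀ σξ : ℝ} {v : Vec d} {ω : Outcome d m n}

/-- As long as all filters of class `j` have signal coefficient below `2`, the margin of the
points of that class is bounded, so that the loss derivative does not degenerate. -/
lemma le_slopeAt (hω : WellBehaved L δ ρ η σ₀ σξ N v ω) (hq : 2 < q) (hη : 0 < η) (hv : v ≠ 0)
    (hL : 1 ≤ L) (hσ₀ : 0 < σ₀) (hσξ : 0 < σξ)
    (hcross : n * (L * σξ) < δ * noiseNorm d σξ) (hρ : ρ ≤ σ₀ / 2)
    (hsum : N * (η / (n * m) * (q * (4 * L ^ 2 * (σ₀ * noiseNorm d σξ)) ^ (q - 1)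
      * (L * noiseNorm d σξ) ^ 2)) ≤ σ₀ * noiseNorm d σξ)
    (hsmallv : 2 * L * (σ₀ * ‖v‖) ≤ 1) (hsmallξ : 4 * L ^ 2 * (σ₀ * noiseNorm d σξ) ≤ 1)
    {j : Bool} {t : ℕ} (ht : t ≤ N) (hΓ : ∀ r, (gradientCoefficients q η v ω).Γ j r t < 2)
    {i : Fin n} (hi : ω.2.1 i = j) : lossSlope (3 ^ q + 1) ≤ slopeAt q η v ω t i := by
  have hc := isDecomposition_gradientCoefficients ω hq hη hv
  refine lossSlope_anti ?_
  have hrel : ∀ (w : Fin m → Vec d) (x : Vec d × Vec d), 0 ≤ branch q w x := by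
    intro w x
    unfold branch polyReLU
    positivity
  have hbr : branch q (iterates q η v ω t j) (sgn (ω.2.1 i) • v, ω.2.2.1 i) ≤ 3 ^ q + 1 := by
    unfold branch
    have hterm : ∀ r ∈ Finset.univ,
        polyReLU q (inner ℝ (iterates q η v ω t j r) (sgn (ω.2.1 i) • v))
        + polyReLU q (inner ℝ (iterates q η v ω t j r) (ω.2.2.1 i)) ≤ 3 ^ q + 1 := by
      intro r _
      have h1 : inner ℝ (iterates q η v ω t j r) (sgn (ω.2.1 i) • v) ≤ (3 : ℝ) := by
        rw [real_inner_smul_right, inner_iterates_signal hω hv hc, hi, mul_sub, mul_add,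
          ← mul_assoc (sgn j), sgn_mul_self, one_mul]
        have h2 := (le_abs_self _).trans
          ((abs_mul _ _).trans_le (mul_le_mul_of_nonneg_left (hω.init_signal j r)
            (abs_nonneg (sgn j))))
        have h3 := (neg_abs_le _).trans'
          (neg_le_neg ((abs_mul _ _).trans_le (mul_le_mul_of_nonneg_left
            (hω.privacy_signal t ht) (abs_nonneg (sgn j)))))
        rw [abs_sgn, one_mul] at h2 h3
        have h4 : ρ * ‖v‖ ≤ σ₀ / 2 * ‖v‖ := by gcongr
        have h5 : 1 * (σ₀ * ‖v‖) ≤ L * (σ₀ * ‖v‖) := by gcongr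
        have h6 := hΓ r
        linarith
      have h7 : inner ℝ (iterates q η v ω t j r) (ω.2.2.1 i) ≤ (1 : ℝ) :=
        (inner_iterates_noise_le hω hL hσ₀ hσξ hcross hρ hc ht j r
          (fun i => abs_Φ_le hω hq hη hv hL hσ₀ hσξ hcross hρ hsum ht j r i) i).trans hsmallξ
      refine add_le_add ?_ ?_
      · exact Real.rpow_le_rpow (le_max_left _ _) (max_le (by norm_num) h1) (by linarith)
      · refine (Real.rpow_le_rpow (le_max_left _ _) (max_le zero_le_one h7) (by linarith)).trans ?_
        rw [Real.one_rpow]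
    have h8 := Finset.sum_le_card_nsmul _ _ _ hterm
    rw [Finset.card_univ, Fintype.card_fin, nsmul_eq_mul] at h8
    calc _ ≤ 1 / (m : ℝ) * (m * (3 ^ q + 1)) := by gcongr
      _ = (m : ℝ) / m * (3 ^ q + 1) := by ring
      _ ≤ 1 * (3 ^ q + 1) := by gcongr; exact div_self_le_one _
      _ = _ := one_mul _
  unfold network
  have h9 := hrel (iterates q η v ω t !j) (sgn (ω.2.1 i) • v, ω.2.2.1 i)
  subst hi
  cases hj : ω.2.1 i <;> rw [hj] at hbr h9 <;> simp [sgn] at hbr h9 ⊢ <;> linarith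

/-- On a typical outcome some filter of each class learns the signal. -/
theorem two_le_iSup_Γ (hω : WellBehaved L δ ρ η σ₀ σξ N v ω) (hq : 2 < q) (hη : 0 < η)
    (hv : v ≠ 0) (hn : 0 < n) (hL : 1 ≤ L) (hσ₀ : 0 < σ₀) (hσξ : 0 < σξ)
    (hcross : n * (L * σξ) < δ * noiseNorm d σξ) (hρ : ρ ≤ σ₀ / 2)
    (hsum : N * (η / (n * m) * (q * (4 * L ^ 2 * (σ₀ * noiseNorm d σξ)) ^ (q - 1)
      * (L * noiseNorm d σξ) ^ 2)) ≤ σ₀ * noiseNorm d σξ)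
    (hsmallv : 2 * L * (σ₀ * ‖v‖) ≤ 1) (hsmallξ : 4 * L ^ 2 * (σ₀ * noiseNorm d σξ) ≤ 1)
    (hstep : η * q * ‖v‖ ^ 2 * lossSlope (3 ^ q + 1) / (4 * m) * 3 ^ (q - 2) ≤ 1)
    (hlong : (σ₀ * ‖v‖ / 2) ^ (-(q - 2)) < N * (η * q * ‖v‖ ^ 2 * lossSlope (3 ^ q + 1) / (4 * m)
      * ((q - 2) / q))) (j : Bool) :
    2 ≤ ⨆ r, (gradientCoefficients q η v ω).Γ j r N := by
  by_contra! hlt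
  have hc := isDecomposition_gradientCoefficients ω hq hη hv
  have hΓN : ∀ r, (gradientCoefficients q η v ω).Γ j r N < 2 := fun r =>
    (le_ciSup (Set.finite_range _).bddAbove r).trans_lt hlt
  have hmono := fun r =>
    monotone_nat_of_le_succ (gradientCoefficients_Γ_le_succ (v := v) ω hq hη j r)
  have hΓ : ∀ t ≤ N, ∀ r, (gradientCoefficients q η v ω).Γ j r t < 2 := fun t ht r =>
    (hmono r ht).trans_lt (hΓN r)
  obtain ⟨r, hr⟩ := hω.init_large j
  set c₀ := lossSlope (3 ^ q + 1) with hc₀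
  have hc₀0 : 0 ≤ c₀ := lossSlope_nonneg _
  set α := η * q * ‖v‖ ^ 2 * c₀ / (4 * m) with hα
  have hα0 : 0 ≤ α := by positivity
  have hs0 : 0 < σ₀ * ‖v‖ := mul_pos hσ₀ (norm_pos_iff.2 hv)
  have hsmall : σ₀ * ‖v‖ ≤ 1 / 2 := by nlinarith
  -- the initialization contributes `σ₀ ‖v‖`, and the privacy noise takes away at most half of it
  have hgrow := steps_mul_le_of_growth (p := q - 2) (α := α) (U := 3) (u₀ := σ₀ * ‖v‖ / 2)
    (u := fun t => (gradientCoefficients q η v ω).Γ j r t + σ₀ * ‖v‖ / 2) (N := N)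
    (by linarith) hα0 (by positivity)
    (by simpa using gradientCoefficients_Γ_nonneg (v := v) ω hq hη j r 0) hstep
    (fun t ht => by have := hΓ t ht.le r; linarith) ?_
  · rw [show q - 2 + 2 = q by ring] at hgrow
    linarith
  intro t ht
  rw [gradientCoefficients_Γ_succ]
  set Γt := (gradientCoefficients q η v ω).Γ j r t with hΓt
  have hΓ0 : 0 ≤ Γt := gradientCoefficients_Γ_nonneg ω hq hη j r t
  have hu0 : 0 ≤ Γt + σ₀ * ‖v‖ / 2 := by positivity
  have hin : Γt + σ₀ * ‖v‖ / 2 ≤ inner ℝ (iterates q η v ω t j r) (sgn j • v) := by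
    rw [real_inner_smul_right, inner_iterates_signal hω hv hc, mul_sub, mul_add,
      ← mul_assoc (sgn j), sgn_mul_self, one_mul]
    have h3 := (le_abs_self _).trans ((abs_mul _ _).trans_le (mul_le_mul_of_nonneg_left
        (hω.privacy_signal t ht.le) (abs_nonneg (sgn j))))
    rw [abs_sgn, one_mul] at h3
    have h4 : ρ * ‖v‖ ≤ σ₀ / 2 * ‖v‖ := by gcongr
    linarith
  have hder := polyReLUDeriv_mono hq hin
  rw [polyReLUDeriv, max_eq_right hu0, show q - 1 = q - 2 + 1 by ring] at hder
  set u := Γt + σ₀ * ‖v‖ / 2 with hu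
  have hsumle : (n : ℝ) / 4 * (c₀ * (q * u ^ (q - 2 + 1)) * ‖v‖ ^ 2) ≤ ∑ i,
      slopeAt q η v ω t i *
        polyReLUDeriv q (inner ℝ (iterates q η v ω t j r) (sgn (ω.2.1 i) • v)) * ‖v‖ ^ 2 := by
    calc _ ≤ ((Finset.univ.filter fun i => ω.2.1 i = j).card : ℝ) *
          (c₀ * (q * u ^ (q - 2 + 1)) * ‖v‖ ^ 2) := by
          gcongr
          exact hω.labels j
      _ ≤ ∑ i ∈ Finset.univ.filter fun i => ω.2.1 i = j, slopeAt q η v ω t i *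
          polyReLUDeriv q (inner ℝ (iterates q η v ω t j r) (sgn (ω.2.1 i) • v)) * ‖v‖ ^ 2 := by
          rw [← nsmul_eq_mul]
          refine Finset.card_nsmul_le_sum _ _ _ fun i hi => ?_
          have hij := (Finset.mem_filter.1 hi).2
          rw [hij]
          gcongr
          · exact slopeAt_nonneg ω t i
          · exact le_slopeAt hω hq hη hv hL hσ₀ hσξ hcross hρ hsum hsmallv hsmallξ ht.le
              (hΓ t ht.le) hij
      _ ≤ _ := Finset.sum_le_sum_of_subset_of_nonneg (Finset.filter_subset _ _) fun i _ _ =>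
          mul_nonneg (mul_nonneg (slopeAt_nonneg ω t i) (polyReLUDeriv_nonneg hq _)) (sq_nonneg _)
  have hfin : η / (n * m) * ((n : ℝ) / 4 * (c₀ * (q * u ^ (q - 2 + 1)) * ‖v‖ ^ 2))
      = α * u ^ (q - 2 + 1) := by
    rw [hα]
    have : (n : ℝ) ≠ 0 := by positivity
    field_simp
  have hmul := mul_le_mul_of_nonneg_left hsumle (show 0 ≤ η / ((n : ℝ) * m) by positivity)
  rw [hfin] at hmul
  linarith

end Deterministic

/-! ### Gaussian tails and a maximal inequality -/

section GaussianTails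

open scoped NNReal

variable {Ω : Type*} [MeasurableSpace Ω] {μ : Measure Ω}

lemma ae_eq_zero_of_map_eq_gaussianReal {X : Ω → ℝ} (hX : Measurable X)
    (hlaw : μ.map X = gaussianReal 0 0) : ∀ᵐ ω ∂μ, X ω = 0 := by
  rw [gaussianReal_zero_var] at hlaw
  have h : ∀ᵐ x ∂(μ.map X), x = 0 := by rw [hlaw, ae_dirac_eq]; rfl
  exact ae_of_ae_map hX.aemeasurable h

lemma integrable_exp_mul_of_map_eq {X : Ω → ℝ} {w : ℝ≥0} (hX : Measurable X)
    (hlaw : μ.map X = gaussianReal 0 w) (l : ℝ) : Integrable (fun ω => Real.exp (l * X ω)) μ := by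
  have h := integrable_exp_mul_gaussianReal (μ := 0) (v := w) l
  rw [← hlaw] at h
  exact h.comp_measurable hX

lemma measure_lt_abs_le [IsProbabilityMeasure μ] {X : Ω → ℝ} {w : ℝ≥0} (hX : Measurable X)
    (hlaw : μ.map X = gaussianReal 0 w) {L s : ℝ} (hL : 0 ≤ L) (hs : √(w : ℝ) ≤ s) :
    μ {ω | L * s < |X ω|} ≤ ENNReal.ofReal (2 * Real.exp (-(L ^ 2 / 2))) := by
  rcases eq_or_ne w 0 with rfl | hw
  · refine le_of_eq_of_le ?_ (zero_le)
    refine measure_mono_null (t := {ω | ¬ X ω = 0}) (fun ω hω h0 => ?_)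
      (ae_iff.1 (ae_eq_zero_of_map_eq_gaussianReal hX hlaw))
    simp only [Set.mem_ofPred_eq, h0, abs_zero] at hω
    have : 0 ≤ s := (Real.sqrt_nonneg _).trans hs
    nlinarith
  · have hsub : ∀ Y : Ω → ℝ, Measurable Y → μ.map Y = gaussianReal 0 w →
        μ {ω | L * s < Y ω} ≤ ENNReal.ofReal (Real.exp (-(L ^ 2 / 2))) := by
      intro Y hY hYlaw
      have hg : HasSubgaussianMGF Y w μ :=
        ⟨fun l => integrable_exp_mul_of_map_eq hY hYlaw l, fun l => by
          rw [mgf_gaussianReal hYlaw]; simp⟩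
      have hwp : (0 : ℝ) < w := by positivity
      have h := hg.measure_ge_le (ε := L * √(w : ℝ)) (by positivity)
      have he : -(L * √(w : ℝ)) ^ 2 / (2 * w) = -(L ^ 2 / 2) := by
        rw [mul_pow, Real.sq_sqrt hwp.le]; field_simp
      rw [he] at h
      rw [← ofReal_measureReal]
      refine ENNReal.ofReal_le_ofReal (le_trans (measureReal_mono fun ω hω => ?_) h)
      have : L * √(w : ℝ) ≤ L * s := by gcongr
      exact this.trans (le_of_lt hω)
    have hneg : μ.map (fun ω => -X ω) = gaussianReal 0 w := by
      have := gaussianReal_map_neg (μ := 0) (v := w)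
      rw [← hlaw, Measure.map_map (by fun_prop) hX] at this
      simpa [hlaw, Function.comp_def] using this
    calc μ {ω | L * s < |X ω|} ≤ μ ({ω | L * s < X ω} ∪ {ω | L * s < -X ω}) :=
          measure_mono fun ω (hω : L * s < |X ω|) => (lt_abs.1 hω).imp id id
      _ ≤ ENNReal.ofReal (Real.exp (-(L ^ 2 / 2))) + ENNReal.ofReal (Real.exp (-(L ^ 2 / 2))) :=
          (measure_union_le _ _).trans (add_le_add (hsub _ hX hlaw) (hsub _ hX.neg hneg))
      _ = _ := by rw [← ENNReal.ofReal_add (by positivity) (by positivity), two_mul]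

/-- The exponential of a random walk with independent centred Gaussian steps is a submartingale. -/
lemma submartingale_exp_sum [IsProbabilityMeasure μ] {X : ℕ → Ω → ℝ} {w : ℝ≥0}
    (hX : ∀ s, Measurable (X s))
    (hind : iIndepFun X μ) (hlaw : ∀ s, μ.map (X s) = gaussianReal 0 w) (l : ℝ) :
    Submartingale (fun t ω => Real.exp (l * ∑ s ∈ Finset.Icc 1 t, X s ω))
      (Filtration.natural X fun s => (hX s).stronglyMeasurable) μ := by
  have hint : ∀ t, Integrable (fun ω => Real.exp (l * ∑ s ∈ Finset.Icc 1 t, X s ω)) μ := by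
    intro t
    have := hind.integrable_exp_mul_sum (t := l) hX (s := Finset.Icc 1 t)
      fun s _ => integrable_exp_mul_of_map_eq (hX s) (hlaw s) l
    simpa [Finset.sum_apply] using this
  have hadp : StronglyAdapted (Filtration.natural X fun s => (hX s).stronglyMeasurable)
      (fun t ω => Real.exp (l * ∑ s ∈ Finset.Icc 1 t, X s ω)) := by
    intro t
    refine Measurable.stronglyMeasurable (Real.measurable_exp.comp
      ((Finset.measurable_sum _ fun s hs => ?_).const_mul l))
    exact (Filtration.stronglyAdapted_natural (fun s => (hX s).stronglyMeasurable) s).measurable.mono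
      (Filtration.mono _ (Finset.mem_Icc.1 hs).2) le_rfl
  refine submartingale_nat hadp hint fun t => ?_
  have hfac : (fun ω => Real.exp (l * ∑ s ∈ Finset.Icc 1 (t + 1), X s ω))
      = (fun ω => Real.exp (l * ∑ s ∈ Finset.Icc 1 t, X s ω)) *
        fun ω => Real.exp (l * X (t + 1) ω) := by
    ext ω
    rw [Pi.mul_apply, Finset.sum_Icc_succ_top (by omega), mul_add, Real.exp_add]
  have hg := integrable_exp_mul_of_map_eq (hX (t + 1)) (hlaw (t + 1)) l
  have hpull := condExp_mul_of_stronglyMeasurable_left (μ := μ) (hadp t)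
    (by rw [← hfac]; exact hint (t + 1)) hg
  have hconst := condExp_indep_eq (μ := μ) (hX (t + 1)).comap_le
    (Filtration.le (Filtration.natural X fun s => (hX s).stronglyMeasurable) t)
    (f := fun ω => Real.exp (l * X (t + 1) ω))
    (Measurable.stronglyMeasurable (Real.measurable_exp.comp
      ((comap_measurable (X (t + 1))).const_mul l)))
    (hind.indep_comap_natural_of_lt (fun s => (hX s).stronglyMeasurable) (Nat.lt_succ_self t))
  have hmean : μ[fun ω => Real.exp (l * X (t + 1) ω)] = Real.exp (w * l ^ 2 / 2) := by
    have := mgf_gaussianReal (hlaw (t + 1)) l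
    simpa [mgf] using this
  rw [← hfac] at hpull
  filter_upwards [hpull, hconst] with ω h1 h2
  rw [h1, Pi.mul_apply, h2, hmean]
  exact le_mul_of_one_le_right (Real.exp_pos _).le (Real.one_le_exp (by positivity))

/-- Doob's inequality for the exponential submartingale, at the optimal exponent. -/
lemma measure_exists_lt_sum_le [IsProbabilityMeasure μ] {X : ℕ → Ω → ℝ} {w : ℝ≥0}
    (hX : ∀ s, Measurable (X s))
    (hind : iIndepFun X μ) (hlaw : ∀ s, μ.map (X s) = gaussianReal 0 w) (N : ℕ) {L : ℝ}
    (hL : 0 ≤ L) :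
    μ {ω | ∃ t ≤ N, L * √(N * w) < ∑ s ∈ Finset.Icc 1 t, X s ω}
      ≤ ENNReal.ofReal (Real.exp (-(L ^ 2 / 2))) := by
  rcases Nat.eq_zero_or_pos N with rfl | hN
  · simp
  rcases eq_or_ne w 0 with rfl | hw
  · refine le_of_eq_of_le ?_ (zero_le)
    have hae : ∀ᵐ ω ∂μ, ∀ s, X s ω = 0 :=
      ae_all_iff.2 fun s => ae_eq_zero_of_map_eq_gaussianReal (hX s) (hlaw s)
    refine measure_mono_null (t := {ω | ¬ ∀ s, X s ω = 0}) (fun ω hω h0 => ?_) (ae_iff.1 hae)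
    obtain ⟨t, -, ht⟩ := hω
    simp [h0] at ht
  have hwp : (0 : ℝ) < N * w := by positivity
  set R := √((N : ℝ) * w) with hR
  have hRp : 0 < R := Real.sqrt_pos.2 hwp
  have hR2 : R ^ 2 = N * w := Real.sq_sqrt hwp.le
  set l := L / R with hl
  have hl0 : 0 ≤ l := by positivity
  have hsub := submartingale_exp_sum hX hind hlaw l
  have hmax := maximal_ineq hsub (fun t ω => (Real.exp_pos _).le)
    (ε := (Real.exp (L ^ 2)).toNNReal) N
  set S := {ω | (((Real.exp (L ^ 2)).toNNReal : ℝ≥0) : ℝ) ≤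
    (Finset.range (N + 1)).sup' Finset.nonempty_range_add_one
      fun k => Real.exp (l * ∑ s ∈ Finset.Icc 1 k, X s ω)} with hS
  have hincl : {ω | ∃ t ≤ N, L * R < ∑ s ∈ Finset.Icc 1 t, X s ω} ⊆ S := by
    rintro ω ⟨t, ht, hlt⟩
    rw [hS, Set.mem_ofPred_eq, Real.coe_toNNReal _ (Real.exp_pos _).le, Finset.le_sup'_iff]
    refine ⟨t, Finset.mem_range.2 (by omega), Real.exp_le_exp.2 ?_⟩
    have h1 : l * (L * R) ≤ l * ∑ s ∈ Finset.Icc 1 t, X s ω := by gcongr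
    have h2 : l * (L * R) = L ^ 2 := by rw [hl]; field_simp
    linarith
  have hmgf : μ[fun ω => Real.exp (l * ∑ s ∈ Finset.Icc 1 N, X s ω)] = Real.exp (L ^ 2 / 2) := by
    have h := hind.mgf_sum (t := l) hX (Finset.Icc 1 N)
    simp only [mgf_gaussianReal (hlaw _), Finset.prod_const, Nat.card_Icc] at h
    rw [mgf] at h
    simp only [Finset.sum_apply] at h
    rw [h, ← Real.exp_nat_mul]
    congr 1
    have : l ^ 2 * (N * w) = L ^ 2 := by rw [← hR2, hl]; field_simp
    push_cast
    simp only [zero_mul, zero_add]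
    linear_combination this / 2
  have hint : ENNReal.ofReal (∫ ω in S, Real.exp (l * ∑ s ∈ Finset.Icc 1 N, X s ω) ∂μ)
      ≤ ENNReal.ofReal (Real.exp (L ^ 2 / 2)) := by
    refine ENNReal.ofReal_le_ofReal (le_of_le_of_eq ?_ hmgf)
    exact setIntegral_le_integral (hsub.integrable N)
      (Filter.Eventually.of_forall fun ω => (Real.exp_pos _).le)
  have hfin := hmax.trans hint
  change ENNReal.ofReal (Real.exp (L ^ 2)) * μ S ≤ _ at hfin
  refine (measure_mono hincl).trans ?_
  rw [show -(L ^ 2 / 2) = L ^ 2 / 2 - L ^ 2 by ring, Real.exp_sub,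
    ENNReal.ofReal_div_of_pos (Real.exp_pos _),
    ENNReal.le_div_iff_mul_le (Or.inl (by simpa using Real.exp_pos _))
      (Or.inl ENNReal.ofReal_ne_top), mul_comm]
  exact hfin

lemma measure_exists_lt_abs_sum_le [IsProbabilityMeasure μ] {X : ℕ → Ω → ℝ} {w : ℝ≥0}
    (hX : ∀ s, Measurable (X s))
    (hind : iIndepFun X μ) (hlaw : ∀ s, μ.map (X s) = gaussianReal 0 w) (N : ℕ) {L : ℝ}
    (hL : 0 ≤ L) :
    μ {ω | ∃ t ≤ N, L * √(N * w) < |∑ s ∈ Finset.Icc 1 t, X s ω|}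
      ≤ ENNReal.ofReal (2 * Real.exp (-(L ^ 2 / 2))) := by
  have hneg : ∀ s, μ.map (fun ω => -X s ω) = gaussianReal 0 w := by
    intro s
    have := gaussianReal_map_neg (μ := 0) (v := w)
    rw [← hlaw s, Measure.map_map (by fun_prop) (hX s)] at this
    simpa [hlaw s, Function.comp_def] using this
  have hind' : iIndepFun (fun s ω => -X s ω) μ :=
    hind.comp (fun _ x => -x) fun _ => measurable_neg
  have h1 := measure_exists_lt_sum_le hX hind hlaw N hL
  have h2 := measure_exists_lt_sum_le (fun s => (hX s).neg) hind' hneg N hL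
  calc _ ≤ μ ({ω | ∃ t ≤ N, L * √(N * w) < ∑ s ∈ Finset.Icc 1 t, X s ω} ∪
        {ω | ∃ t ≤ N, L * √(N * w) < ∑ s ∈ Finset.Icc 1 t, -X s ω}) := by
        refine measure_mono fun ω hω => ?_
        obtain ⟨t, ht, hlt⟩ := hω
        rcases lt_abs.1 hlt with h | h
        · exact Or.inl ⟨t, ht, h⟩
        · exact Or.inr ⟨t, ht, by rwa [Finset.sum_neg_distrib]⟩
    _ ≤ ENNReal.ofReal (Real.exp (-(L ^ 2 / 2))) + ENNReal.ofReal (Real.exp (-(L ^ 2 / 2))) :=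
        (measure_union_le _ _).trans (add_le_add h1 h2)
    _ = _ := by rw [← ENNReal.ofReal_add (by positivity) (by positivity), two_mul]

end GaussianTails

section MultivariateGaussian

open scoped NNReal Matrix MatrixOrder

variable {d : ℕ}

lemma norm_sqrt_mulVec_sq {S : Matrix (Fin d) (Fin d) ℝ} (hS : S.PosSemidef) (x : Vec d) :
    ‖Matrix.toEuclideanCLM (𝕜 := ℝ) (CFC.sqrt S) x‖ ^ 2 = x.ofLp ⬝ᵥ S *ᵥ x.ofLp := by
  have hsa : IsSelfAdjoint (Matrix.toEuclideanCLM (𝕜 := ℝ) (CFC.sqrt S)) :=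
    (CFC.sqrt_nonneg S).isSelfAdjoint.map _
  rw [← real_inner_self_eq_norm_sq, ← ContinuousLinearMap.adjoint_inner_right,
    hsa.adjoint_eq, ← ContinuousLinearMap.comp_apply,
    ← ContinuousLinearMap.mul_def, ← map_mul, CFC.sqrt_mul_sqrt_self _ hS.nonneg,
    Matrix.inner_toEuclideanCLM]

lemma map_inner_multivariateGaussian {S : Matrix (Fin d) (Fin d) ℝ} (hS : S.PosSemidef)
    (u : Vec d) : (multivariateGaussian 0 S).map (fun x => inner ℝ x u)
      = gaussianReal 0 (u.ofLp ⬝ᵥ S *ᵥ u.ofLp).toNNReal := by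
  have h := IsGaussian.map_eq_gaussianReal (μ := multivariateGaussian 0 S) (innerSL ℝ u)
  have hf : (fun x : Vec d => inner ℝ x u) = ⇑(innerSL ℝ u) := by
    ext x; simp [real_inner_comm]
  rw [hf, h]
  congr 1
  · rw [ContinuousLinearMap.integral_comp_id_comm, integral_id_multivariateGaussian, map_zero]
    exact IsGaussian.integrable_id
  · congr 1
    rw [← covarianceBilin_multivariateGaussian (μ := 0) hS, covarianceBilin_apply_eq_cov,
      covariance_self]
    · rfl
    · exact (by fun_prop : Measurable _).aemeasurable
    · exact IsGaussian.memLp_two_id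

lemma smul_one_posSemidef (σ : ℝ) : (σ ^ 2 • (1 : Matrix (Fin d) (Fin d) ℝ)).PosSemidef :=
  Matrix.PosSemidef.one.smul (sq_nonneg σ)

lemma dotProduct_smul_one (σ : ℝ) (u : Vec d) :
    u.ofLp ⬝ᵥ (σ ^ 2 • (1 : Matrix (Fin d) (Fin d) ℝ)) *ᵥ u.ofLp = σ ^ 2 * ‖u‖ ^ 2 := by
  rw [Matrix.smul_mulVec, Matrix.one_mulVec, dotProduct_smul, smul_eq_mul,
    EuclideanSpace.real_norm_sq_eq]
  simp [dotProduct, pow_two]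

lemma dotProduct_dataNoiseCov (v : Vec d) (σ : ℝ) (u : Vec d) :
    u.ofLp ⬝ᵥ (dataNoiseCov v σ) *ᵥ u.ofLp
      = σ ^ 2 * (‖u‖ ^ 2 - (‖v‖ ^ 2)⁻¹ * (inner ℝ u v) ^ 2) := by
  have hx : (inner ℝ u v : ℝ) = v.ofLp ⬝ᵥ u.ofLp := by
    simp [PiLp.inner_apply, dotProduct]
  have hn : ‖u‖ ^ 2 = u.ofLp ⬝ᵥ u.ofLp := by
    rw [EuclideanSpace.real_norm_sq_eq]
    simp [dotProduct, pow_two]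
  rw [hx, hn, dataNoiseCov, Matrix.smul_mulVec, Matrix.sub_mulVec, Matrix.smul_mulVec,
    Matrix.vecMulVec_mulVec, dotProduct_smul, dotProduct_sub, dotProduct_smul, Matrix.one_mulVec]
  simp [dotProduct_comm u.ofLp v.ofLp, pow_two]

lemma dotProduct_dataNoiseCov_le (v : Vec d) (σ : ℝ) (u : Vec d) :
    u.ofLp ⬝ᵥ (dataNoiseCov v σ) *ᵥ u.ofLp ≤ σ ^ 2 * ‖u‖ ^ 2 := by
  rw [dotProduct_dataNoiseCov]
  gcongr
  have : 0 ≤ (‖v‖ ^ 2)⁻¹ * (inner ℝ u v) ^ 2 := by positivity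
  linarith

lemma multivariateGaussian_lt_abs_inner_le {S : Matrix (Fin d) (Fin d) ℝ} (hS : S.PosSemidef)
    {σ L : ℝ} (hσ : 0 ≤ σ) (hL : 0 ≤ L) (u : Vec d)
    (hu : u.ofLp ⬝ᵥ S *ᵥ u.ofLp ≤ σ ^ 2 * ‖u‖ ^ 2) :
    multivariateGaussian 0 S {x | L * (σ * ‖u‖) < |inner ℝ x u|}
      ≤ ENNReal.ofReal (2 * Real.exp (-(L ^ 2 / 2))) := by
  refine measure_lt_abs_le (by fun_prop) (map_inner_multivariateGaussian hS u) hL ?_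
  rw [Real.coe_toNNReal', Real.sqrt_le_left (by positivity), mul_pow]
  exact max_le hu (by positivity)

lemma dataNoise_ae_orthogonal {v : Vec d} (hv : v ≠ 0) (σ : ℝ) :
    ∀ᵐ x ∂(multivariateGaussian 0 (dataNoiseCov v σ)), inner ℝ x v = 0 := by
  refine ae_eq_zero_of_map_eq_gaussianReal (by fun_prop) ?_
  rw [map_inner_multivariateGaussian (dataNoiseCov_posSemidef v σ), dotProduct_dataNoiseCov,
    real_inner_self_eq_norm_sq]
  have : ‖v‖ ≠ 0 := norm_ne_zero_iff.2 hv
  congr 1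
  rw [show ‖v‖ ^ 2 - (‖v‖ ^ 2)⁻¹ * (‖v‖ ^ 2) ^ 2 = 0 by field_simp; ring]
  simp

/-- The privacy noise accumulated along a fixed direction, uniformly in time. -/
lemma infinitePi_lt_abs_sum_inner_le {σ L : ℝ} (hσ : 0 ≤ σ) (hL : 0 ≤ L) (u : Vec d) (N : ℕ) :
    Measure.infinitePi (fun _ : ℕ => multivariateGaussian 0 (σ ^ 2 • (1 : Matrix (Fin d) (Fin d) ℝ)))
      {z | ∃ t ≤ N, L * (σ * √(N : ℝ) * ‖u‖) < |inner ℝ (∑ s ∈ Finset.Icc 1 t, z s) u|}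
      ≤ ENNReal.ofReal (2 * Real.exp (-(L ^ 2 / 2))) := by
  set ν := multivariateGaussian 0 (σ ^ 2 • (1 : Matrix (Fin d) (Fin d) ℝ)) with hν
  have hind : iIndepFun (fun (s : ℕ) (z : ℕ → Vec d) => (inner ℝ (z s) u : ℝ))
      (Measure.infinitePi fun _ => ν) :=
    iIndepFun_infinitePi (X := fun _ x => (inner ℝ x u : ℝ)) fun _ => by fun_prop
  have hlaw : ∀ s : ℕ, (Measure.infinitePi fun _ => ν).map (fun z : ℕ → Vec d =>
      (inner ℝ (z s) u : ℝ)) = gaussianReal 0 (σ ^ 2 * ‖u‖ ^ 2).toNNReal := by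
    intro s
    have h1 := map_inner_multivariateGaussian (smul_one_posSemidef σ) u
    rw [dotProduct_smul_one, ← hν] at h1
    have h2 := Measure.map_map (μ := Measure.infinitePi fun _ : ℕ => ν)
      (g := fun x : Vec d => (inner ℝ x u : ℝ)) (f := fun z : ℕ → Vec d => z s)
      (by fun_prop) (by fun_prop)
    rw [Measure.infinitePi_map_eval, h1] at h2
    exact h2.symm
  have h := measure_exists_lt_abs_sum_le (fun s => by fun_prop) hind hlaw N hL
  refine le_trans (measure_mono fun z hz => ?_) h
  obtain ⟨t, ht, hlt⟩ := hz
  refine ⟨t, ht, ?_⟩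
  rw [Real.coe_toNNReal _ (by positivity), ← mul_pow, Real.sqrt_mul (by positivity),
    Real.sqrt_sq (by positivity), ← sum_inner]
  rwa [show √(N : ℝ) * (σ * ‖u‖) = σ * √(N : ℝ) * ‖u‖ by ring]

/-- The squared norm of a standard Gaussian vector is at least of the order of the dimension, up to
an exponentially small probability. -/
lemma exists_stdGaussian_norm_sq_lt_le : ∃ κ₀ : ℝ, 0 < κ₀ ∧ ∀ d : ℕ,
    stdGaussian (Vec d) {x | ‖x‖ ^ 2 < 2 * κ₀ * d} ≤ ENNReal.ofReal (Real.exp (-(2 * κ₀ * d))) := by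
  set γ := gaussianReal 0 1 with hγ
  have hbd : ∀ x : ℝ, 0 < Real.exp (-x ^ 2) ∧ Real.exp (-x ^ 2) ≤ 1 := fun x =>
    ⟨Real.exp_pos _, Real.exp_le_one_iff.2 (by nlinarith [sq_nonneg x])⟩
  have hint : Integrable (fun x : ℝ => Real.exp (-x ^ 2)) γ :=
    Integrable.of_bound (by fun_prop) 1 (Filter.Eventually.of_forall fun x => by
      rw [Real.norm_of_nonneg (hbd x).1.le]; exact (hbd x).2)
  set M := ∫ x, Real.exp (-x ^ 2) ∂γ with hM
  have hM0 : 0 < M := integral_exp_pos hint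
  have hM1 : M < 1 := by
    have hpos : 0 < ∫ x, (1 - Real.exp (-x ^ 2)) ∂γ := by
      rw [integral_pos_iff_support_of_nonneg (fun x => sub_nonneg.2 (hbd x).2)
        ((integrable_const _).sub hint)]
      have hsupp : ({0} : Set ℝ)ᶜ ⊆ Function.support fun x : ℝ => 1 - Real.exp (-x ^ 2) := by
        intro x hx
        have : Real.exp (-x ^ 2) < 1 := by
          rw [Real.exp_lt_one_iff]
          have hx0 : x ≠ 0 := hx
          have : 0 < x ^ 2 := by positivity
          linarith
        exact (sub_pos.2 this).ne'
      refine lt_of_lt_of_le ?_ (measure_mono hsupp)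
      have hz : γ {0} = 0 :=
        gaussianReal_absolutelyContinuous 0 one_ne_zero (by simp)
      rw [prob_compl_eq_one_sub (measurableSet_singleton _), hz]
      simp
    rw [integral_sub (integrable_const _) hint] at hpos
    simpa using hpos
  have hlog : Real.log M < 0 := Real.log_neg hM0 hM1
  refine ⟨-Real.log M / 4, by linarith, fun d => ?_⟩
  rw [← map_pi_eq_stdGaussian, Measure.map_apply (by fun_prop)
    (measurableSet_lt (by fun_prop) (by fun_prop))]
  rw [← ofReal_measureReal]
  refine ENNReal.ofReal_le_ofReal ?_
  -- Markov's inequality for `exp (-∑ x_k²)`, whose mean is `M ^ d`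
  have hprod : ∫ x : Fin d → ℝ, ∏ k, Real.exp (-(x k) ^ 2) ∂(Measure.pi fun _ => γ) = M ^ d := by
    rw [integral_fintype_prod_eq_prod (f := fun _ x => Real.exp (-x ^ 2))]
    simp [hM]
  have hintp : Integrable (fun x : Fin d → ℝ => ∏ k, Real.exp (-(x k) ^ 2))
      (Measure.pi fun _ => γ) :=
    Integrable.fintype_prod (f := fun _ x => Real.exp (-x ^ 2)) fun _ => hint
  have hmarkov := mul_meas_ge_le_integral_of_nonneg (μ := Measure.pi fun _ : Fin d => γ)
    (f := fun x : Fin d → ℝ => ∏ k, Real.exp (-(x k) ^ 2))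
    (Filter.Eventually.of_forall fun x => Finset.prod_nonneg fun k _ => (Real.exp_pos _).le) hintp
    (Real.exp (Real.log M / 2 * d))
  rw [hprod] at hmarkov
  have hincl : (WithLp.toLp 2 ⁻¹' {x : Vec d | ‖x‖ ^ 2 < 2 * (-Real.log M / 4) * d}) ⊆
      {x : Fin d → ℝ | Real.exp (Real.log M / 2 * d) ≤ ∏ k, Real.exp (-(x k) ^ 2)} := by
    intro x hx
    have hx' : ‖WithLp.toLp 2 x‖ ^ 2 < 2 * (-Real.log M / 4) * d := hx
    rw [EuclideanSpace.real_norm_sq_eq] at hx'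
    rw [Set.mem_ofPred_eq, ← Real.exp_sum, Real.exp_le_exp, Finset.sum_neg_distrib]
    linarith
  refine (measureReal_mono hincl).trans ?_
  have hMd : M ^ d = Real.exp (Real.log M * d) := by
    rw [mul_comm, Real.exp_nat_mul, Real.exp_log hM0]
  rw [hMd] at hmarkov
  rw [← mul_le_mul_iff_right₀ (Real.exp_pos (Real.log M / 2 * d)), ← Real.exp_add]
  refine hmarkov.trans (le_of_eq ?_)
  congr 1
  ring

/-- The data noise loses only the component along `v` compared with a standard Gaussian vector, so
its norm is at least of order `σ √d`. -/
lemma dataNoise_norm_lt_le {κ₀ : ℝ}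
    (hκ : stdGaussian (Vec d) {x | ‖x‖ ^ 2 < 2 * κ₀ * d}
      ≤ ENNReal.ofReal (Real.exp (-(2 * κ₀ * d))))
    (hκ₀ : 0 < κ₀) {v : Vec d} {σ L : ℝ} (hL : 0 ≤ L)
    (hLd : L ^ 2 ≤ κ₀ * d) :
    multivariateGaussian 0 (dataNoiseCov v σ) {x | ‖x‖ < √κ₀ * noiseNorm d σ}
      ≤ ENNReal.ofReal (Real.exp (-(2 * κ₀ * d)))
        + ENNReal.ofReal (2 * Real.exp (-(L ^ 2 / 2))) := by
  have htail : stdGaussian (Vec d) {x | L * (1 * ‖v‖) < |inner ℝ x v|}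
      ≤ ENNReal.ofReal (2 * Real.exp (-(L ^ 2 / 2))) := by
    rw [← multivariateGaussian_zero_one]
    refine multivariateGaussian_lt_abs_inner_le Matrix.PosSemidef.one zero_le_one hL v ?_
    have := dotProduct_smul_one 1 v
    simp only [one_pow, one_smul] at this
    rw [this, one_pow]
  rw [multivariateGaussian, Measure.map_apply (by fun_prop)
    (measurableSet_lt (by fun_prop) (by fun_prop))]
  refine le_trans (measure_mono fun x hx => ?_) ((measure_union_le _ _).trans (add_le_add hκ htail))
  by_contra hnot
  have h1 : 2 * κ₀ * d ≤ ‖x‖ ^ 2 := not_lt.1 fun h => hnot (Or.inl h)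
  have h2 : |inner ℝ x v| ≤ L * (1 * ‖v‖) := not_lt.1 fun h => hnot (Or.inr h)
  have h3 : ‖(0 : Vec d) + Matrix.toEuclideanCLM (𝕜 := ℝ) (CFC.sqrt (dataNoiseCov v σ)) x‖
    < √κ₀ * noiseNorm d σ := hx
  rw [zero_add] at h3
  have h4 := norm_sqrt_mulVec_sq (dataNoiseCov_posSemidef v σ) x
  rw [dotProduct_dataNoiseCov] at h4
  have h5 : (‖v‖ ^ 2)⁻¹ * (inner ℝ x v) ^ 2 ≤ L ^ 2 := by
    rcases eq_or_ne v 0 with rfl | hv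
    · simp; positivity
    · have hv0 : 0 < ‖v‖ := norm_pos_iff.2 hv
      rw [inv_mul_le_iff₀ (by positivity), ← sq_abs, ← mul_pow, mul_comm]
      rw [one_mul] at h2
      gcongr
  have h6 : (√κ₀ * noiseNorm d σ) ^ 2 = σ ^ 2 * (κ₀ * d) := by
    unfold noiseNorm
    rw [mul_pow, mul_pow, Real.sq_sqrt hκ₀.le, Real.sq_sqrt (Nat.cast_nonneg d)]
    ring
  have h7 := pow_lt_pow_left₀ h3 (norm_nonneg _) two_ne_zero
  rw [h4, h6] at h7
  have h8 : σ ^ 2 * (κ₀ * d) ≤ σ ^ 2 * (‖x‖ ^ 2 - (‖v‖ ^ 2)⁻¹ * (inner ℝ x v) ^ 2) := by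
    gcongr
    linarith
  linarith

lemma exists_coord_of_lt_norm {x : Vec d} {B : ℝ} (hB : 0 ≤ B) (h : B * √(d : ℝ) < ‖x‖) :
    ∃ k, B < |x k| := by
  by_contra! hle
  have h1 : ‖x‖ ^ 2 ≤ (B * √(d : ℝ)) ^ 2 := by
    rw [EuclideanSpace.real_norm_sq_eq, mul_pow, Real.sq_sqrt (Nat.cast_nonneg d)]
    calc ∑ i, x i ^ 2 ≤ ∑ i : Fin d, B ^ 2 := Finset.sum_le_sum fun i _ => by
          rw [← sq_abs]; gcongr; exact hle i
      _ = _ := by simp [mul_comm]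
  exact absurd (pow_le_pow_left₀ (by positivity) h.le 2) (by
    intro h2
    have := pow_lt_pow_left₀ h (by positivity) two_ne_zero
    linarith)

lemma dataNoise_lt_norm_le (v : Vec d) {σ L : ℝ} (hσ : 0 ≤ σ) (hL : 0 ≤ L) :
    multivariateGaussian 0 (dataNoiseCov v σ) {x | L * noiseNorm d σ < ‖x‖}
      ≤ ENNReal.ofReal (d * (2 * Real.exp (-(L ^ 2 / 2)))) := by
  have hk : ∀ k : Fin d, multivariateGaussian 0 (dataNoiseCov v σ) {x | L * σ < |x k|}
      ≤ ENNReal.ofReal (2 * Real.exp (-(L ^ 2 / 2))) := by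
    intro k
    have := multivariateGaussian_lt_abs_inner_le (dataNoiseCov_posSemidef v σ) hσ hL
      (EuclideanSpace.single k 1) (dotProduct_dataNoiseCov_le v σ _)
    simpa [EuclideanSpace.inner_single_right] using this
  calc _ ≤ multivariateGaussian 0 (dataNoiseCov v σ) (⋃ k, {x | L * σ < |x k|}) := by
        refine measure_mono fun x (hx : L * noiseNorm d σ < ‖x‖) => ?_
        obtain ⟨k, hk⟩ := exists_coord_of_lt_norm (x := x) (B := L * σ) (by positivity)
          (by unfold noiseNorm at hx; linarith)
        exact Set.mem_iUnion.2 ⟨k, hk⟩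
    _ ≤ ∑ k, multivariateGaussian 0 (dataNoiseCov v σ) {x | L * σ < |x k|} :=
        measure_iUnion_fintype_le _ _
    _ ≤ ∑ k : Fin d, ENNReal.ofReal (2 * Real.exp (-(L ^ 2 / 2))) :=
        Finset.sum_le_sum fun k _ => hk k
    _ = _ := by
        rw [Finset.sum_const, Finset.card_univ, Fintype.card_fin, nsmul_eq_mul,
          ENNReal.ofReal_mul (Nat.cast_nonneg d), ENNReal.ofReal_natCast]

end MultivariateGaussian

/-! ### Typical outcomes are likely -/

section FairCoins

/-- Hoeffding's inequality for the number of labels of a given class. -/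
lemma labels_card_lt_le (n : ℕ) (j : Bool) :
    (Measure.pi fun _ : Fin n => (PMF.uniformOfFintype Bool).toMeasure)
      {y | ((Finset.univ.filter fun i => y i = j).card : ℝ) < n / 4}
      ≤ ENNReal.ofReal (Real.exp (-(n / 8 : ℝ))) := by
  set ν := (PMF.uniformOfFintype Bool).toMeasure with hν
  set X : Bool → ℝ := fun b => if b = j then -1 else 0 with hX
  have hXm : Measurable X := measurable_of_finite X
  have hmean : ∫ b, X b ∂ν = -(1 / 2) := by
    rw [hν, PMF.integral_eq_sum]
    cases j <;> simp [hX, PMF.uniformOfFintype_apply]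
  have hsub : HasSubgaussianMGF (fun b => X b - ∫ b, X b ∂ν) ((‖(0 : ℝ) - (-1)‖₊ / 2) ^ 2) ν :=
    hasSubgaussianMGF_of_mem_Icc hXm.aemeasurable (Filter.Eventually.of_forall fun b => by
      simp only [hX]; split_ifs <;> simp)
  have hind : iIndepFun (fun (i : Fin n) (y : Fin n → Bool) => X (y i) - ∫ b, X b ∂ν)
      (Measure.pi fun _ => ν) :=
    iIndepFun_pi (X := fun _ b => X b - ∫ b, X b ∂ν) fun _ =>
      (hXm.sub measurable_const).aemeasurable
  have hsub' : ∀ i ∈ (Finset.univ : Finset (Fin n)), HasSubgaussianMGF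
      (fun y : Fin n → Bool => X (y i) - ∫ b, X b ∂ν) ((‖(0 : ℝ) - (-1)‖₊ / 2) ^ 2)
      (Measure.pi fun _ => ν) := by
    intro i _
    have h := measurePreserving_eval (fun _ : Fin n => ν) i
    rw [← h.map_eq] at hsub
    have := HasSubgaussianMGF.of_map h.measurable.aemeasurable hsub
    rw [h.map_eq] at this
    exact this
  have hH := HasSubgaussianMGF.measure_sum_ge_le_of_iIndepFun hind hsub' (ε := (n : ℝ) / 4)
    (by positivity)
  rw [← ofReal_measureReal]
  refine ENNReal.ofReal_le_ofReal (le_trans (measureReal_mono fun y hy => ?_) (hH.trans ?_))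
  · have hy' : ((Finset.univ.filter fun i => y i = j).card : ℝ) < n / 4 := hy
    have hsum : ∑ i, (X (y i) - ∫ b, X b ∂ν)
        = n / 2 - ((Finset.univ.filter fun i => y i = j).card : ℝ) := by
      rw [Finset.sum_sub_distrib, hmean]
      simp only [hX, Finset.sum_ite, Finset.sum_const, Finset.card_univ, Fintype.card_fin,
        nsmul_eq_mul]
      ring
    rw [Set.mem_ofPred_eq, hsum]
    linarith
  · rw [Real.exp_le_exp]
    have : ((∑ i : Fin n, (‖(0 : ℝ) - (-1)‖₊ / 2) ^ 2 : NNReal) : ℝ) = n / 4 := by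
      push_cast
      simp
      ring
    rw [this]
    rcases Nat.eq_zero_or_pos n with rfl | hn
    · simp
    · have : (0 : ℝ) < n := by exact_mod_cast hn
      apply le_of_eq
      field_simp
      norm_num

end FairCoins

section Initialization

/-- With many filters, one of them starts with a large component along a given direction. -/
lemma exists_forall_inner_lt_le : ∃ p₀ : ℝ, 0 < p₀ ∧ ∀ (d m : ℕ) (σ : ℝ) (u : Vec d),
    0 < σ → u ≠ 0 →
    (Measure.pi fun _ : Fin m =>
        multivariateGaussian 0 (σ ^ 2 • (1 : Matrix (Fin d) (Fin d) ℝ)))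
      {w | ∀ r, inner ℝ (w r) u < σ * ‖u‖} ≤ ENNReal.ofReal (Real.exp (-(p₀ * m))) := by
  set γ := gaussianReal 0 1 with hγ
  have hlt : γ.real (Set.Iio 1) < 1 := by
    have hpos : 0 < γ (Set.Ici 1) := by
      rw [pos_iff_ne_zero]
      intro h0
      have := gaussianReal_absolutelyContinuous' 0 one_ne_zero h0
      simp at this
    have hreal : 0 < γ.real (Set.Ici 1) := ENNReal.toReal_pos hpos.ne' (measure_ne_top _ _)
    have h := probReal_compl_eq_one_sub (μ := γ) (measurableSet_Ici (a := (1 : ℝ)))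
    rw [Set.compl_Ici] at h
    linarith
  refine ⟨1 - γ.real (Set.Iio 1), by linarith, fun d m σ u hσ hu => ?_⟩
  have hs : 0 < σ * ‖u‖ := mul_pos hσ (norm_pos_iff.2 hu)
  set ν := multivariateGaussian 0 (σ ^ 2 • (1 : Matrix (Fin d) (Fin d) ℝ)) with hν
  have hone : ν {x | inner ℝ x u < σ * ‖u‖} = γ (Set.Iio 1) := by
    have h1 := map_inner_multivariateGaussian (smul_one_posSemidef σ) u
    rw [dotProduct_smul_one, ← mul_pow, ← hν] at h1
    have h2 := gaussianReal_map_const_mul (μ := 0) (v := 1) (σ * ‖u‖)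
    have h3 : (σ * ‖u‖ * 0 : ℝ) = 0 := mul_zero _
    have h4 : (NNReal.mk ((σ * ‖u‖) ^ 2) (sq_nonneg _) * 1 : NNReal)
        = ((σ * ‖u‖) ^ 2).toNNReal := by
      rw [mul_one]
      exact NNReal.eq (by rw [Real.coe_toNNReal _ (sq_nonneg _)]; rfl)
    rw [h3, h4, ← h1] at h2
    have h5 : ν {x | inner ℝ x u < σ * ‖u‖}
        = (ν.map fun x => (inner ℝ x u : ℝ)) (Set.Iio (σ * ‖u‖)) :=
      (Measure.map_apply (f := fun x : Vec d => (inner ℝ x u : ℝ)) (by fun_prop)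
        measurableSet_Iio).symm
    rw [h5, ← h2, Measure.map_apply (measurable_const_mul (σ * ‖u‖)) measurableSet_Iio]
    congr 1
    ext x
    simp only [Set.mem_preimage, Set.mem_Iio]
    constructor
    · intro h; nlinarith
    · intro h; nlinarith
  have hset : {w : Fin m → Vec d | ∀ r, inner ℝ (w r) u < σ * ‖u‖}
      = Set.univ.pi fun _ => {x | inner ℝ x u < σ * ‖u‖} := by
    ext w; simp
  rw [hset, Measure.pi_pi, Finset.prod_const, hone, Finset.card_univ, Fintype.card_fin,
    ← ofReal_measureReal, ← ENNReal.ofReal_pow measureReal_nonneg]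
  refine ENNReal.ofReal_le_ofReal ?_
  rw [show -((1 - γ.real (Set.Iio 1)) * m) = m * (γ.real (Set.Iio 1) - 1) by ring,
    Real.exp_nat_mul]
  refine pow_le_pow_left₀ measureReal_nonneg ?_ m
  have := Real.add_one_le_exp (γ.real (Set.Iio 1) - 1)
  linarith

end Initialization

section Product

variable {α β : Type*} [MeasurableSpace α] [MeasurableSpace β] {μ : Measure α} {ν : Measure β}

lemma prod_le_of_forall_left [IsProbabilityMeasure μ] [IsProbabilityMeasure ν] {S : Set (α × β)}
    (hS : MeasurableSet S) {p : ENNReal} (h : ∀ y, μ {x | (x, y) ∈ S} ≤ p) :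
    μ.prod ν S ≤ p := by
  rw [Measure.prod_apply_symm hS]
  calc _ ≤ ∫⁻ _, p ∂ν := lintegral_mono fun y => h y
    _ = p := by simp

lemma prod_le_of_forall_right [IsProbabilityMeasure μ] [IsProbabilityMeasure ν] {S : Set (α × β)}
    (hS : MeasurableSet S) {p : ENNReal} (h : ∀ x, ν {y | (x, y) ∈ S} ≤ p) :
    μ.prod ν S ≤ p := by
  rw [Measure.prod_apply hS]
  calc _ ≤ ∫⁻ _, p ∂μ := lintegral_mono fun x => h x
    _ = p := by simp

lemma measurePreserving_measure_le {f : α → β} (hf : MeasurePreserving f μ ν) (S : Set β) :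
    μ {x | f x ∈ S} ≤ ν S := by
  rw [← hf.map_eq]
  exact Measure.le_map_apply hf.measurable.aemeasurable S

lemma measure_exists_le {ι : Type*} [Fintype ι] {p : ι → α → Prop} {e : ENNReal}
    (h : ∀ i, μ {x | p i x} ≤ e) : μ {x | ∃ i, p i x} ≤ Fintype.card ι * e := by
  have : {x | ∃ i, p i x} = ⋃ i, {x | p i x} := by ext; simp
  rw [this]
  refine (measure_iUnion_fintype_le _ _).trans ((Finset.sum_le_sum fun i _ => h i).trans ?_)
  rw [Finset.sum_const, nsmul_eq_mul, Finset.card_univ]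

end Product

section Marginals

variable {d m n : ℕ} (v : Vec d) (σ₀ σξ σz : ℝ)

lemma measurePreserving_class (j : Bool) :
    MeasurePreserving (fun ω : Outcome d m n => ω.1 j) (outcomeLaw d m n v σ₀ σξ σz)
      (Measure.pi fun _ : Fin m =>
        multivariateGaussian 0 (σ₀ ^ 2 • (1 : Matrix (Fin d) (Fin d) ℝ))) :=
  (measurePreserving_eval (fun _ : Bool => Measure.pi fun _ : Fin m =>
    multivariateGaussian 0 (σ₀ ^ 2 • (1 : Matrix (Fin d) (Fin d) ℝ))) j).comp
    measurePreserving_fst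

lemma measurePreserving_labels :
    MeasurePreserving (fun ω : Outcome d m n => ω.2.1) (outcomeLaw d m n v σ₀ σξ σz)
      (Measure.pi fun _ : Fin n => (PMF.uniformOfFintype Bool).toMeasure) :=
  measurePreserving_fst.comp measurePreserving_snd

lemma measurePreserving_privacy :
    MeasurePreserving (fun ω : Outcome d m n => ω.2.2.2) (outcomeLaw d m n v σ₀ σξ σz)
      (Measure.infinitePi fun _ : ℕ =>
        multivariateGaussian 0 (σz ^ 2 • (1 : Matrix (Fin d) (Fin d) ℝ))) :=
  measurePreserving_snd.comp (measurePreserving_snd.comp measurePreserving_snd)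

lemma measurePreserving_noise (i : Fin n) :
    MeasurePreserving (fun ω : Outcome d m n => ω.2.2.1 i) (outcomeLaw d m n v σ₀ σξ σz)
      (multivariateGaussian 0 (dataNoiseCov v σξ)) :=
  (measurePreserving_eval (fun _ : Fin n => multivariateGaussian 0 (dataNoiseCov v σξ)) i).comp
    (measurePreserving_fst.comp (measurePreserving_snd.comp measurePreserving_snd))

lemma measurePreserving_filter (j : Bool) (r : Fin m) :
    MeasurePreserving (fun ω : Outcome d m n => ω.1 j r) (outcomeLaw d m n v σ₀ σξ σz)
      (multivariateGaussian 0 (σ₀ ^ 2 • (1 : Matrix (Fin d) (Fin d) ℝ))) :=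
  (measurePreserving_eval (fun _ : Fin m =>
    multivariateGaussian 0 (σ₀ ^ 2 • (1 : Matrix (Fin d) (Fin d) ℝ))) r).comp
    (measurePreserving_class v σ₀ σξ σz j)

lemma measurePreserving_filter_noise (j : Bool) (r : Fin m) (i : Fin n) :
    MeasurePreserving (fun ω : Outcome d m n => (ω.1 j r, ω.2.2.1 i))
      (outcomeLaw d m n v σ₀ σξ σz)
      ((multivariateGaussian 0 (σ₀ ^ 2 • (1 : Matrix (Fin d) (Fin d) ℝ))).prod
        (multivariateGaussian 0 (dataNoiseCov v σξ))) :=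
  MeasurePreserving.prod
    ((measurePreserving_eval (fun _ : Fin m =>
      multivariateGaussian 0 (σ₀ ^ 2 • (1 : Matrix (Fin d) (Fin d) ℝ))) r).comp
      (measurePreserving_eval (fun _ : Bool => Measure.pi fun _ : Fin m =>
        multivariateGaussian 0 (σ₀ ^ 2 • (1 : Matrix (Fin d) (Fin d) ℝ))) j))
    ((measurePreserving_eval (fun _ : Fin n => multivariateGaussian 0 (dataNoiseCov v σξ)) i).comp
      (measurePreserving_fst.comp measurePreserving_snd))

lemma measurePreserving_noise_privacy (i : Fin n) :
    MeasurePreserving (fun ω : Outcome d m n => (ω.2.2.1 i, ω.2.2.2))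
      (outcomeLaw d m n v σ₀ σξ σz)
      ((multivariateGaussian 0 (dataNoiseCov v σξ)).prod (Measure.infinitePi fun _ : ℕ =>
        multivariateGaussian 0 (σz ^ 2 • (1 : Matrix (Fin d) (Fin d) ℝ)))) :=
  (MeasurePreserving.prod
    (measurePreserving_eval (fun _ : Fin n => multivariateGaussian 0 (dataNoiseCov v σξ)) i)
    (MeasurePreserving.id _)).comp (measurePreserving_snd.comp measurePreserving_snd)

lemma measurePreserving_noise_noise {i i' : Fin n} (h : i ≠ i') :
    MeasurePreserving (fun ω : Outcome d m n => (ω.2.2.1 i, ω.2.2.1 i'))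
      (outcomeLaw d m n v σ₀ σξ σz)
      ((multivariateGaussian 0 (dataNoiseCov v σξ)).prod
        (multivariateGaussian 0 (dataNoiseCov v σξ))) := by
  have hpair : MeasurePreserving (fun ξ : Fin n → Vec d => (ξ i, ξ i'))
      (Measure.pi fun _ : Fin n => multivariateGaussian 0 (dataNoiseCov v σξ))
      ((multivariateGaussian 0 (dataNoiseCov v σξ)).prod
        (multivariateGaussian 0 (dataNoiseCov v σξ))) := by
    refine ⟨by fun_prop, ?_⟩
    rw [← Measure.infinitePi_eq_pi]
    exact Measure.infinitePi_map_eval_prod h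
  exact hpair.comp (measurePreserving_fst.comp (measurePreserving_snd.comp measurePreserving_snd))

end Marginals

section UnionBound

variable {d m n : ℕ} (v : Vec d) {σ₀ σξ σz L : ℝ}

lemma outcomeLaw_isProbabilityMeasure (σ₀ σξ σz : ℝ) :
    IsProbabilityMeasure (outcomeLaw d m n v σ₀ σξ σz) := by
  constructor
  have h := (measurePreserving_labels (m := m) (n := n) v σ₀ σξ σz).measure_preimage
    MeasurableSet.univ.nullMeasurableSet
  exact h.trans measure_univ

lemma outcome_init_signal_le (hσ₀ : 0 ≤ σ₀) (hL : 0 ≤ L) :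
    outcomeLaw d m n v σ₀ σξ σz {ω | ∃ jr : Bool × Fin m,
      L * σ₀ * ‖v‖ < |inner ℝ (ω.1 jr.1 jr.2) v|}
      ≤ (2 * m : ℕ) * ENNReal.ofReal (2 * Real.exp (-(L ^ 2 / 2))) := by
  refine (measure_exists_le (e := ENNReal.ofReal (2 * Real.exp (-(L ^ 2 / 2))))
    fun jr => ?_).trans_eq (by simp)
  refine (measurePreserving_measure_le (measurePreserving_filter v σ₀ σξ σz jr.1 jr.2)
    {x | L * σ₀ * ‖v‖ < |inner ℝ x v|}).trans ?_
  simp_rw [mul_assoc]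
  exact multivariateGaussian_lt_abs_inner_le (smul_one_posSemidef σ₀) hσ₀ hL v
    (dotProduct_smul_one σ₀ v).le

lemma outcome_init_noise_le (hσ₀ : 0 ≤ σ₀) (hL : 0 ≤ L) :
    outcomeLaw d m n v σ₀ σξ σz {ω | ∃ jri : (Bool × Fin m) × Fin n,
      L * σ₀ * ‖ω.2.2.1 jri.2‖ < |inner ℝ (ω.1 jri.1.1 jri.1.2) (ω.2.2.1 jri.2)|}
      ≤ (2 * m * n : ℕ) * ENNReal.ofReal (2 * Real.exp (-(L ^ 2 / 2))) := by
  refine (measure_exists_le (e := ENNReal.ofReal (2 * Real.exp (-(L ^ 2 / 2))))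
    fun jri => ?_).trans_eq (by simp)
  refine (measurePreserving_measure_le
    (measurePreserving_filter_noise v σ₀ σξ σz jri.1.1 jri.1.2 jri.2)
    {p | L * σ₀ * ‖p.2‖ < |inner ℝ p.1 p.2|}).trans ?_
  refine prod_le_of_forall_left (measurableSet_lt (by fun_prop) (by fun_prop)) fun y => ?_
  simp only [Set.mem_ofPred_eq, mul_assoc]
  exact multivariateGaussian_lt_abs_inner_le (smul_one_posSemidef σ₀) hσ₀ hL y
    (dotProduct_smul_one σ₀ y).le

lemma outcome_cross_le (hσξ : 0 ≤ σξ) (hL : 0 ≤ L) :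
    outcomeLaw d m n v σ₀ σξ σz {ω | ∃ p : Fin n × Fin n, p.1 ≠ p.2 ∧
      L * σξ * ‖ω.2.2.1 p.2‖ < |inner ℝ (ω.2.2.1 p.1) (ω.2.2.1 p.2)|}
      ≤ (n * n : ℕ) * ENNReal.ofReal (2 * Real.exp (-(L ^ 2 / 2))) := by
  refine (measure_exists_le (e := ENNReal.ofReal (2 * Real.exp (-(L ^ 2 / 2))))
    fun p => ?_).trans_eq (by simp)
  by_cases hp : p.1 = p.2
  · simp [hp]
  refine (measure_mono fun ω hω => ?_).trans ((measurePreserving_measure_le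
    (measurePreserving_noise_noise v σ₀ σξ σz hp)
    {p | L * σξ * ‖p.2‖ < |inner ℝ p.1 p.2|}).trans ?_)
  · exact (show _ ∧ _ from hω).2
  refine prod_le_of_forall_left (measurableSet_lt (by fun_prop) (by fun_prop)) fun y => ?_
  simp only [Set.mem_ofPred_eq, mul_assoc]
  exact multivariateGaussian_lt_abs_inner_le (dataNoiseCov_posSemidef v σξ) hσξ hL y
    (dotProduct_dataNoiseCov_le v σξ y)

lemma outcome_noise_upper_le (hσξ : 0 ≤ σξ) (hL : 0 ≤ L) :
    outcomeLaw d m n v σ₀ σξ σz {ω | ∃ i : Fin n, L * noiseNorm d σξ < ‖ω.2.2.1 i‖}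
      ≤ (n * d : ℕ) * ENNReal.ofReal (2 * Real.exp (-(L ^ 2 / 2))) := by
  refine (measure_exists_le fun i => (measurePreserving_measure_le
    (measurePreserving_noise v σ₀ σξ σz i) {x | L * noiseNorm d σξ < ‖x‖}).trans
    (dataNoise_lt_norm_le v hσξ hL)).trans_eq ?_
  rw [Fintype.card_fin, ENNReal.ofReal_mul (Nat.cast_nonneg d), ENNReal.ofReal_natCast,
    Nat.cast_mul, mul_assoc]

lemma outcome_noise_lower_le {κ₀ : ℝ} (hκ₀ : 0 < κ₀)
    (hκ : stdGaussian (Vec d) {x | ‖x‖ ^ 2 < 2 * κ₀ * d}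
      ≤ ENNReal.ofReal (Real.exp (-(2 * κ₀ * d)))) (hL : 0 ≤ L) (hLd : L ^ 2 ≤ κ₀ * d) :
    outcomeLaw d m n v σ₀ σξ σz {ω | ∃ i : Fin n, ‖ω.2.2.1 i‖ < √κ₀ * noiseNorm d σξ}
      ≤ (n : ℕ) * (ENNReal.ofReal (Real.exp (-(2 * κ₀ * d)))
        + ENNReal.ofReal (2 * Real.exp (-(L ^ 2 / 2)))) := by
  refine (measure_exists_le fun i => (measurePreserving_measure_le
    (measurePreserving_noise v σ₀ σξ σz i) {x | ‖x‖ < √κ₀ * noiseNorm d σξ}).trans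
    (dataNoise_norm_lt_le hκ hκ₀ hL hLd)).trans_eq (by simp)

lemma outcome_privacy_signal_le {η : ℝ} (hη : 0 < η) (hσz : 0 ≤ σz) (hL : 0 ≤ L) (N : ℕ) :
    outcomeLaw d m n v σ₀ σξ σz {ω | ∃ t ≤ N, L * (η * σz * √(N : ℝ)) * ‖v‖
      < |η * inner ℝ (∑ s ∈ Finset.Icc 1 t, ω.2.2.2 s) v|}
      ≤ ENNReal.ofReal (2 * Real.exp (-(L ^ 2 / 2))) := by
  refine le_trans (measure_mono fun ω hω => ?_) ((measurePreserving_measure_le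
    (measurePreserving_privacy v σ₀ σξ σz)
    {z | ∃ t ≤ N, L * (σz * √(N : ℝ) * ‖v‖) < |inner ℝ (∑ s ∈ Finset.Icc 1 t, z s) v|}).trans
    (infinitePi_lt_abs_sum_inner_le hσz hL v N))
  obtain ⟨t, ht, hlt⟩ := hω
  refine ⟨t, ht, ?_⟩
  rw [abs_mul, abs_of_pos hη] at hlt
  refine lt_of_mul_lt_mul_left (lt_of_eq_of_lt ?_ hlt) hη.le
  ring

lemma outcome_privacy_noise_le {η : ℝ} (hη : 0 < η) (hσz : 0 ≤ σz) (hL : 0 ≤ L) (N : ℕ) :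
    outcomeLaw d m n v σ₀ σξ σz {ω | ∃ i : Fin n, ∃ t ≤ N,
      L * (η * σz * √(N : ℝ)) * ‖ω.2.2.1 i‖
      < |η * inner ℝ (∑ s ∈ Finset.Icc 1 t, ω.2.2.2 s) (ω.2.2.1 i)|}
      ≤ (n : ℕ) * ENNReal.ofReal (2 * Real.exp (-(L ^ 2 / 2))) := by
  refine (measure_exists_le (e := ENNReal.ofReal (2 * Real.exp (-(L ^ 2 / 2))))
    fun i => ?_).trans_eq (by simp)
  set S : Set (Vec d × (ℕ → Vec d)) := {p | ∃ t ≤ N, L * (σz * √(N : ℝ) * ‖p.1‖)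
    < |inner ℝ (∑ s ∈ Finset.Icc 1 t, p.2 s) p.1|} with hS
  have hmeas : MeasurableSet S := by
    have : S = ⋃ t ∈ Finset.range (N + 1), {p : Vec d × (ℕ → Vec d) |
        L * (σz * √(N : ℝ) * ‖p.1‖) < |inner ℝ (∑ s ∈ Finset.Icc 1 t, p.2 s) p.1|} := by
      ext p
      simp [hS]
    rw [this]
    refine Finset.measurableSet_biUnion _ fun t _ => measurableSet_lt (by fun_prop) ?_
    have h1 : Measurable fun p : Vec d × (ℕ → Vec d) => ∑ s ∈ Finset.Icc 1 t, p.2 s :=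
      Finset.measurable_sum _ fun s _ => by fun_prop
    exact (h1.inner measurable_fst).abs
  refine le_trans (measure_mono fun ω hω => ?_) ((measurePreserving_measure_le
    (measurePreserving_noise_privacy v σ₀ σξ σz i) S).trans
    (prod_le_of_forall_right hmeas fun x => infinitePi_lt_abs_sum_inner_le hσz hL x N))
  obtain ⟨t, ht, hlt⟩ := hω
  refine ⟨t, ht, ?_⟩
  rw [abs_mul, abs_of_pos hη] at hlt
  refine lt_of_mul_lt_mul_left (lt_of_eq_of_lt ?_ hlt) hη.le
  ring

lemma outcome_labels_le :
    outcomeLaw d m n v σ₀ σξ σz {ω | ∃ j : Bool,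
      ((Finset.univ.filter fun i => ω.2.1 i = j).card : ℝ) < n / 4}
      ≤ 2 * ENNReal.ofReal (Real.exp (-(n / 8 : ℝ))) := by
  refine (measure_exists_le fun j => (measurePreserving_measure_le
    (measurePreserving_labels v σ₀ σξ σz)
    {y | ((Finset.univ.filter fun i => y i = j).card : ℝ) < n / 4}).trans
    (labels_card_lt_le n j)).trans_eq (by simp)

lemma norm_sgn_smul (j : Bool) : ‖sgn j • v‖ = ‖v‖ := by
  rw [norm_smul, Real.norm_eq_abs, abs_sgn, one_mul]

/-- A typical outcome occurs with high probability. -/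
theorem exists_outcomeLaw_not_wellBehaved_le : ∃ κ₀ p₀ : ℝ, 0 < κ₀ ∧ 0 < p₀ ∧
    ∀ (d m n N : ℕ) (v : Vec d) (σ₀ σξ σz η L : ℝ), v ≠ 0 → 0 < σ₀ → 0 ≤ σξ → 0 ≤ σz → 0 < η →
    0 ≤ L → L ^ 2 ≤ κ₀ * d →
    outcomeLaw d m n v σ₀ σξ σz
      {ω | ¬ WellBehaved L (√κ₀) (L * (η * σz * √(N : ℝ))) η σ₀ σξ N v ω}
      ≤ ENNReal.ofReal ((2 * m + 2 * m * n + n * n + n * d + n + 1 + n) *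
          (2 * Real.exp (-(L ^ 2 / 2))) + n * Real.exp (-(2 * κ₀ * d))
          + 2 * Real.exp (-(n / 8)) + 2 * Real.exp (-(p₀ * m))) := by
  obtain ⟨κ₀, hκ₀, hκ⟩ := exists_stdGaussian_norm_sq_lt_le
  obtain ⟨p₀, hp₀, hp⟩ := exists_forall_inner_lt_le
  refine ⟨κ₀, p₀, hκ₀, hp₀, fun d m n N v σ₀ σξ σz η L hv hσ₀ hσξ hσz hη hL hLd => ?_⟩
  have B1 := outcome_init_signal_le (m := m) (n := n) (σξ := σξ) (σz := σz) v hσ₀.le hL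
  have B2 := outcome_init_noise_le (m := m) (n := n) (σξ := σξ) (σz := σz) v hσ₀.le hL
  have B3 := outcome_cross_le (m := m) (n := n) (σ₀ := σ₀) (σz := σz) v hσξ hL
  have B4 := outcome_noise_upper_le (m := m) (n := n) (σ₀ := σ₀) (σz := σz) v hσξ hL
  have B5 := outcome_noise_lower_le (m := m) (n := n) (σ₀ := σ₀) (σz := σz) (σξ := σξ) v hκ₀
    (hκ d) hL hLd
  have B6 := outcome_privacy_signal_le (m := m) (n := n) (σ₀ := σ₀) (σξ := σξ) v hη hσz hL N
  have B7 := outcome_privacy_noise_le (m := m) (n := n) (σ₀ := σ₀) (σξ := σξ) v hη hσz hL N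
  have B8 := outcome_labels_le (m := m) (n := n) (σ₀ := σ₀) (σξ := σξ) (σz := σz) v
  have B9 : outcomeLaw d m n v σ₀ σξ σz {ω | ∃ j : Bool, ∀ r,
      inner ℝ (ω.1 j r) (sgn j • v) < σ₀ * ‖sgn j • v‖}
      ≤ 2 * ENNReal.ofReal (Real.exp (-(p₀ * m))) := by
    refine (measure_exists_le fun j => (measurePreserving_measure_le
      (measurePreserving_class v σ₀ σξ σz j)
      {w | ∀ r, inner ℝ (w r) (sgn j • v) < σ₀ * ‖sgn j • v‖}).trans
      (hp d m σ₀ (sgn j • v) hσ₀ ?_)).trans_eq (by simp)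
    rw [← norm_ne_zero_iff, norm_sgn_smul]
    exact norm_ne_zero_iff.2 hv
  have B10 : outcomeLaw d m n v σ₀ σξ σz {ω | ∃ i : Fin n, ¬ inner ℝ (ω.2.2.1 i) v = 0} ≤ 0 := by
    refine (measure_exists_le fun i => (measurePreserving_measure_le
      (measurePreserving_noise v σ₀ σξ σz i) {x | ¬ inner ℝ x v = 0}).trans
      (ae_iff.1 (dataNoise_ae_orthogonal hv σξ)).le).trans_eq (by simp)
  set P := outcomeLaw d m n v σ₀ σξ σz with hP
  set E := 2 * Real.exp (-(L ^ 2 / 2)) with hE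
  have hE0 : 0 ≤ E := by positivity
  have hunion := (measure_union_le _ _).trans (add_le_add
    ((measure_union_le _ _).trans (add_le_add
    ((measure_union_le _ _).trans (add_le_add
    ((measure_union_le _ _).trans (add_le_add
    ((measure_union_le _ _).trans (add_le_add
    ((measure_union_le _ _).trans (add_le_add
    ((measure_union_le _ _).trans (add_le_add
    ((measure_union_le _ _).trans (add_le_add
    ((measure_union_le _ _).trans (add_le_add B1 B2)) B3)) B4)) B5)) B6)) B7)) B8)) B9)) B10)
  refine (measure_mono fun ω hω => ?_).trans (hunion.trans (le_of_eq ?_))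
  · by_contra hnot
    simp only [Set.mem_union, not_or] at hnot
    obtain ⟨⟨⟨⟨⟨⟨⟨⟨⟨h1, h2⟩, h3⟩, h4⟩, h5⟩, h6⟩, h7⟩, h8⟩, h9⟩, h10⟩ := hnot
    refine hω ⟨fun i => ?_, fun i => ?_, fun i => ?_, fun i i' hi => ?_, fun j r i => ?_,
      fun j r => ?_, fun j => ?_, fun t ht => ?_, fun t ht i => ?_, fun j => ?_⟩
    · exact not_not.1 fun h => h10 ⟨i, h⟩
    · exact not_lt.1 fun h => h5 ⟨i, h⟩
    · exact not_lt.1 fun h => h4 ⟨i, h⟩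
    · exact not_lt.1 fun h => h3 ⟨(i, i'), hi, h⟩
    · exact not_lt.1 fun h => h2 ⟨((j, r), i), h⟩
    · exact not_lt.1 fun h => h1 ⟨(j, r), h⟩
    · by_contra! h
      refine h9 ⟨j, fun r => ?_⟩
      rw [norm_sgn_smul, real_inner_smul_right]
      exact h r
    · exact not_lt.1 fun h => h6 ⟨t, ht, h⟩
    · exact not_lt.1 fun h => h7 ⟨i, t, ht, h⟩
    · exact not_lt.1 fun h => h8 ⟨j, h⟩
  · have hnat : ∀ k : ℕ, (k : ENNReal) = ENNReal.ofReal k := fun k =>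
      (ENNReal.ofReal_natCast k).symm
    have htwo : (2 : ENNReal) = ENNReal.ofReal 2 := by simp
    rw [hnat, hnat, hnat, hnat, hnat, htwo, add_zero,
      ← ENNReal.ofReal_add (Real.exp_nonneg (-(2 * κ₀ * d))) hE0]
    simp only [← ENNReal.ofReal_mul (Nat.cast_nonneg _), ← ENNReal.ofReal_mul zero_le_two]
    repeat rw [← ENNReal.ofReal_add (by positivity) (by positivity)]
    congr 1
    push_cast
    ring

end UnionBound

/-! ### The parameter regime -/

section Regime

variable {q κ e x y : ℝ}

/-- The bounds on the initialization, in terms of `x = σ₀ ‖v‖`, `y = σ₀ ‖ξ‖` and `e = n ε`, force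
the signal-to-noise ratio `x / y` to be at least of order `e`. -/
lemma regime_bounds (hq : 2 < q) (hκ : 1 ≤ κ) (he : 0 < e) (hx0 : 0 < x)
    (hlow : κ * e ^ (-(1 / q)) ≤ x) (hx : x ≤ κ⁻¹) (hy : y ≤ κ⁻¹ * e ^ (-((q + 1) / q))) :
    1 ≤ e ∧ κ ^ q ≤ x ^ q * e ∧ y * (κ ^ 2 * e) ≤ x ∧ 1 / x ≤ e := by
  set w := e ^ (1 / q) with hw
  have hw0 : 0 < w := by positivity
  have hκ0 : 0 < κ := by linarith
  have hwq : w ^ q = e := by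
    rw [hw, ← Real.rpow_mul he.le, one_div_mul_cancel (by linarith), Real.rpow_one]
  rw [Real.rpow_neg he.le, ← hw, mul_inv_le_iff₀ hw0] at hlow
  have hexp : e ^ (-((q + 1) / q)) = (w * e)⁻¹ := by
    rw [Real.rpow_neg he.le, show (q + 1) / q = 1 / q + 1 by field_simp; ring,
      Real.rpow_add_one he.ne']
  rw [hexp] at hy
  have hxκ : x * κ ≤ 1 := by
    have := mul_le_mul_of_nonneg_right hx hκ0.le
    rwa [inv_mul_cancel₀ hκ0.ne'] at this
  have hκw : κ ^ 2 ≤ w := by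
    calc κ ^ 2 = κ * κ := by ring
      _ ≤ x * w * κ := by gcongr
      _ = x * κ * w := by ring
      _ ≤ 1 * w := by gcongr
      _ = w := one_mul w
  have hw1 : 1 ≤ w := by nlinarith
  have hwe : w ≤ e := by
    calc w = w ^ (1 : ℝ) := (Real.rpow_one w).symm
      _ ≤ w ^ q := Real.rpow_le_rpow_of_exponent_le hw1 (by linarith)
      _ = e := hwq
  refine ⟨hw1.trans hwe, ?_, ?_, ?_⟩
  · calc κ ^ q ≤ (x * w) ^ q := Real.rpow_le_rpow hκ0.le hlow (by linarith)
      _ = x ^ q * e := by rw [Real.mul_rpow hx0.le hw0.le, hwq]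
  · calc y * (κ ^ 2 * e) ≤ κ⁻¹ * (w * e)⁻¹ * (κ ^ 2 * e) := by gcongr
      _ = κ / w := by field_simp
      _ ≤ x := by rwa [div_le_iff₀ hw0]
  · rw [div_le_iff₀ hx0]
    calc 1 ≤ κ := hκ
      _ ≤ x * w := hlow
      _ ≤ e * x := by rw [mul_comm]; gcongr

lemma log_one_div_le (hx : 0 < x) : Real.log (1 / x) ≤ 1 / x :=
  (Real.log_le_sub_one_of_pos (by positivity)).trans (by linarith)

lemma firstStageLength_eq {d : ℕ} (m : ℕ) (v : Vec d) (η : ℝ) {σ₀ : ℝ} (hσ₀ : 0 < σ₀)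
    (hv : v ≠ 0) : firstStageLength q m v η σ₀ = Real.log (1 / (σ₀ * ‖v‖)) * 4 ^ (q - 1) * m /
      (η * q * (σ₀ * ‖v‖) ^ (q - 2) * ‖v‖ ^ 2) := by
  have hv0 : 0 < ‖v‖ := norm_pos_iff.2 hv
  unfold firstStageLength
  rw [Real.mul_rpow hσ₀.le hv0.le, show ‖v‖ ^ q = ‖v‖ ^ (q - 2) * ‖v‖ ^ 2 by
    rw [← Real.rpow_natCast ‖v‖ 2, ← Real.rpow_add hv0]; norm_num]
  congr 1
  ring

variable {d m n N T : ℕ} {v : Vec d} {η σ₀ X ε c B L : ℝ}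

/-- During the first stage the privacy noise accumulates to less than the initialization. -/
lemma privacy_noise_small (hq : 2 < q) (hκ : 1 ≤ κ) (hv : v ≠ 0) (hσ₀ : 0 < σ₀) (hη : 0 < η)
    (hX : 0 < X) (hm : 0 < m) (he : 0 < n * ε) (hL : 0 ≤ L)
    (hx1 : σ₀ * ‖v‖ ≤ 1) (hyx : σ₀ * X ≤ σ₀ * ‖v‖)
    (hxe : κ ^ q ≤ (σ₀ * ‖v‖) ^ q * (n * ε)) (hc0 : 0 ≤ c) (hc : c ≤ B)
    (hT : (T : ℝ) ≤ B * (m * n * ε * σ₀ / (η * (‖v‖ + X))))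
    (hN : (N : ℝ) ≤ firstStageLength q m v η σ₀)
    (hκB : 2 * L * B ^ 2 * 2 ^ q ≤ κ) (hB : 1 ≤ B) :
    L * (η * (c * √(T : ℝ) * (‖v‖ + X) / (m * n * ε)) * √(N : ℝ)) ≤ σ₀ / 2 := by
  have hv0 : 0 < ‖v‖ := norm_pos_iff.2 hv
  have hm0 : (0 : ℝ) < m := by exact_mod_cast hm
  set x := σ₀ * ‖v‖ with hx
  have hx0 : 0 < x := mul_pos hσ₀ hv0
  have hmne : (m : ℝ) * n * ε = m * (n * ε) := by ring
  rw [hmne] at hT ⊢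
  set e := n * ε with he'
  set Q := η * (‖v‖ + X) / (m * e) with hQ
  have hQ0 : 0 < Q := by positivity
  have hTQ : T * Q ≤ B * σ₀ := by
    calc T * Q ≤ B * (m * e * σ₀ / (η * (‖v‖ + X))) * Q := by gcongr
      _ = B * σ₀ := by rw [hQ]; field_simp
  have hκq : κ ^ 2 ≤ κ ^ q := by
    rw [← Real.rpow_natCast κ 2]
    exact Real.rpow_le_rpow_of_exponent_le hκ (by norm_num; linarith)
  have hκ2 : 0 < κ ^ 2 := by positivity
  have hNQ : N * Q ≤ σ₀ * (4 ^ q / κ ^ 2) := by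
    rw [firstStageLength_eq m v η hσ₀ hv] at hN
    calc N * Q ≤ Real.log (1 / x) * 4 ^ (q - 1) * m / (η * q * x ^ (q - 2) * ‖v‖ ^ 2) * Q := by
          gcongr
      _ = σ₀ * (4 ^ (q - 1) * (Real.log (1 / x) * (x + σ₀ * X)) / (q * (x ^ q * e))) := by
          have h1 : x ^ q = x ^ (q - 2) * x ^ 2 := by
            rw [← Real.rpow_natCast x 2, ← Real.rpow_add hx0]; norm_num
          rw [h1, hQ, show x + σ₀ * X = σ₀ * (‖v‖ + X) by rw [hx]; ring]
          have h2 : x ^ (q - 2) ≠ 0 := by positivity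
          have h3 : x ^ 2 = σ₀ ^ 2 * ‖v‖ ^ 2 := by rw [hx]; ring
          rw [h3]
          field_simp
      _ ≤ σ₀ * (4 ^ (q - 1) * 2 / (2 * κ ^ 2)) := by
          have h4 : Real.log (1 / x) * (x + σ₀ * X) ≤ 2 := by
            have hl0 : 0 ≤ Real.log (1 / x) := Real.log_nonneg (by
              rw [le_div_iff₀ hx0]; linarith)
            calc Real.log (1 / x) * (x + σ₀ * X) ≤ 1 / x * (x + x) := by
                  gcongr
                  exact log_one_div_le hx0
              _ = 2 := by field_simp; norm_num
          gcongr
          exact hκq.trans hxe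
      _ ≤ σ₀ * (4 ^ q / κ ^ 2) := by
          rw [mul_comm (4 ^ (q - 1) : ℝ) 2, mul_div_mul_left _ _ two_ne_zero]
          gcongr
          · norm_num
          · linarith
  have heq : η * (c * √(T : ℝ) * (‖v‖ + X) / (m * e)) * √(N : ℝ)
      = c * (√(T : ℝ) * √(N : ℝ) * Q) := by rw [hQ]; ring
  have h4q : (4 : ℝ) ^ q = (2 ^ q) ^ 2 := by
    rw [← Real.rpow_natCast, ← Real.rpow_mul (by norm_num), mul_comm, Real.rpow_mul (by norm_num)]
    norm_num
  have hsq : (√(T : ℝ) * √(N : ℝ) * Q) ^ 2 ≤ (B * σ₀ * (2 ^ q / κ)) ^ 2 := by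
    calc (√(T : ℝ) * √(N : ℝ) * Q) ^ 2 = (T * Q) * (N * Q) := by
          rw [mul_pow, mul_pow, Real.sq_sqrt (Nat.cast_nonneg _), Real.sq_sqrt (Nat.cast_nonneg _)]
          ring
      _ ≤ (B * σ₀) * (σ₀ * (4 ^ q / κ ^ 2)) := by gcongr
      _ = B * (σ₀ * (2 ^ q / κ)) ^ 2 := by rw [h4q, mul_pow, div_pow]; ring
      _ ≤ B ^ 2 * (σ₀ * (2 ^ q / κ)) ^ 2 := by
          gcongr
          nlinarith
      _ = _ := by ring
  have hle := (pow_le_pow_iff_left₀ (by positivity) (by positivity) two_ne_zero).1 hsq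
  rw [heq]
  calc L * (c * (√(T : ℝ) * √(N : ℝ) * Q)) ≤ L * (B * (B * σ₀ * (2 ^ q / κ))) := by gcongr
    _ = σ₀ / 2 * ((2 * L * B ^ 2 * 2 ^ q) / κ) := by ring
    _ ≤ σ₀ / 2 * 1 := by
        gcongr
        exact (div_le_one (by linarith)).2 hκB
    _ = _ := mul_one _

/-- During the first stage the noise coefficients cannot grow beyond their initial order. -/
lemma noise_memorization_small (hq : 2 < q) (hκ : 1 ≤ κ) (hv : v ≠ 0) (hσ₀ : 0 < σ₀)
    (hη : 0 < η) (hX : 0 < X) (hm : 0 < m) (hn : 0 < n) (hL : 1 ≤ L)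
    (hx1 : σ₀ * ‖v‖ ≤ 1) (he1 : 1 ≤ e) (hxe : 1 / (σ₀ * ‖v‖) ≤ e)
    (hyx : σ₀ * X * (κ ^ 2 * e) ≤ σ₀ * ‖v‖) (hκL : 16 * L ^ 2 ≤ κ)
    (hN : (N : ℝ) ≤ firstStageLength q m v η σ₀) :
    N * (η / (n * m) * (q * (4 * L ^ 2 * (σ₀ * X)) ^ (q - 1) * (L * X) ^ 2)) ≤ σ₀ * X := by
  have hv0 : 0 < ‖v‖ := norm_pos_iff.2 hv
  have hm0 : (0 : ℝ) < m := by exact_mod_cast hm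
  have hn1 : (1 : ℝ) ≤ n := by exact_mod_cast hn
  rw [firstStageLength_eq m v η hσ₀ hv] at hN
  set x := σ₀ * ‖v‖ with hx
  have hx0 : 0 < x := mul_pos hσ₀ hv0
  set y := σ₀ * X with hy
  have hy0 : 0 < y := mul_pos hσ₀ hX
  have hl0 : 0 ≤ Real.log (1 / x) := Real.log_nonneg (by rw [le_div_iff₀ hx0]; linarith)
  have hle : Real.log (1 / x) ≤ e := (log_one_div_le hx0).trans hxe
  have he0 : 0 < e := by linarith
  have hκ0 : 0 < κ := by linarith
  have hq0 : 0 < q := by linarith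
  have hyx' : y / x ≤ (κ ^ 2 * e)⁻¹ := by
    rw [div_le_iff₀ hx0, inv_mul_eq_div, le_div_iff₀ (by positivity)]
    exact hyx
  have hκ2 : κ ≤ κ ^ 2 := by nlinarith
  have hmain : e * (16 * L ^ 2) ^ (q - 1) * L ^ 2 * (y / x) ^ q ≤ 1 := by
    calc e * (16 * L ^ 2) ^ (q - 1) * L ^ 2 * (y / x) ^ q
        = e * (16 * L ^ 2) ^ (q - 1) * L ^ 2 * ((y / x) ^ (q - 1) * (y / x)) := by
          rw [← Real.rpow_add_one (by positivity)]; norm_num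
      _ ≤ e * (κ ^ 2) ^ (q - 1) * κ ^ 2 * (((κ ^ 2)⁻¹) ^ (q - 1) * (κ ^ 2 * e)⁻¹) := by
          have h1 : y / x ≤ (κ ^ 2)⁻¹ := hyx'.trans (by
            apply inv_anti₀ (by positivity)
            exact le_mul_of_one_le_right (by positivity) he1)
          gcongr
          · linarith
          · linarith
          · nlinarith
          · linarith
      _ = 1 := by
          rw [Real.inv_rpow (by positivity)]
          have : (κ ^ 2) ^ (q - 1) ≠ 0 := by positivity
          field_simp
  have hident : Real.log (1 / x) * 4 ^ (q - 1) * m / (η * q * x ^ (q - 2) * ‖v‖ ^ 2)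
      * (η / (n * m) * (q * (4 * L ^ 2 * y) ^ (q - 1) * (L * X) ^ 2))
      = Real.log (1 / x) * (16 * L ^ 2) ^ (q - 1) * L ^ 2 * (y / x) ^ q * y / n := by
    have h1 : (4 * L ^ 2 * y) ^ (q - 1) = (4 * L ^ 2) ^ (q - 1) * y ^ (q - 1) :=
      Real.mul_rpow (by positivity) hy0.le
    have h2 : (16 * L ^ 2) ^ (q - 1) = 4 ^ (q - 1) * (4 * L ^ 2) ^ (q - 1) := by
      rw [← Real.mul_rpow (by norm_num) (by positivity)]; ring_nf
    have h3 : (y / x) ^ q = y ^ (q - 1) * y / (x ^ (q - 2) * x ^ 2) := by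
      rw [Real.div_rpow hy0.le hx0.le, ← Real.rpow_add_one hy0.ne', ← Real.rpow_natCast x 2,
        ← Real.rpow_add hx0]
      norm_num
    have h4 : y ^ 2 * ‖v‖ ^ 2 = X ^ 2 * x ^ 2 := by rw [hy, hx]; ring
    have hxq : x ^ (q - 2) ≠ 0 := by positivity
    rw [h1, h2, h3]
    field_simp
    linear_combination -h4
  calc _ ≤ Real.log (1 / x) * 4 ^ (q - 1) * m / (η * q * x ^ (q - 2) * ‖v‖ ^ 2)
      * (η / (n * m) * (q * (4 * L ^ 2 * y) ^ (q - 1) * (L * X) ^ 2)) := by gcongr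
    _ = _ := hident
    _ ≤ e * (16 * L ^ 2) ^ (q - 1) * L ^ 2 * (y / x) ^ q * y / 1 := by gcongr
    _ ≤ 1 * y / 1 := by gcongr
    _ = y := by ring

end Regime

/-! ### The first stage -/

section Regime

variable {q κ : ℝ} {d m n : ℕ} {v : Vec d} {η σ₀ c₀ : ℝ}

lemma firstStageLength_ge (hq : 2 < q) (hv : v ≠ 0) (hσ₀ : 0 < σ₀) (hη : 0 < η) (hm : 0 < m)
    (hκ : 0 < κ) (hx1 : σ₀ * ‖v‖ ≤ 1) (hlog : 1 ≤ Real.log (1 / (σ₀ * ‖v‖)))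
    (hstep : η * ‖v‖ ^ 2 ≤ κ⁻¹) : κ / q ≤ firstStageLength q m v η σ₀ := by
  have hv0 : 0 < ‖v‖ := norm_pos_iff.2 hv
  have hx0 : 0 < σ₀ * ‖v‖ := mul_pos hσ₀ hv0
  have hq0 : 0 < q := by linarith
  have hm1 : (1 : ℝ) ≤ m := by exact_mod_cast hm
  have h4 : (1 : ℝ) ≤ 4 ^ (q - 1) := Real.one_le_rpow (by norm_num) (by linarith)
  have hxq : (σ₀ * ‖v‖) ^ (q - 2) ≤ 1 := Real.rpow_le_one hx0.le hx1 (by linarith)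
  rw [firstStageLength_eq m v η hσ₀ hv]
  calc κ / q = 1 * 1 * 1 / (q * 1 * κ⁻¹) := by field_simp
    _ ≤ Real.log (1 / (σ₀ * ‖v‖)) * 4 ^ (q - 1) * m
        / (q * (σ₀ * ‖v‖) ^ (q - 2) * (η * ‖v‖ ^ 2)) := by gcongr
    _ = _ := by congr 1; ring

/-- The first stage is long enough for the signal to be learned: its logarithmic factor exceeds
the constants, depending on `q` only, that the blow-up of the signal coefficient costs. -/
lemma first_stage_long (hq : 2 < q) (hv : v ≠ 0) (hσ₀ : 0 < σ₀) (hη : 0 < η) (hm : 0 < m)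
    (hκ : 2 * q ≤ κ) (hx1 : σ₀ * ‖v‖ ≤ 1) (hlog1 : 1 ≤ Real.log (1 / (σ₀ * ‖v‖)))
    (hc₀ : 0 < c₀) (hlog : 8 * q / (c₀ * (q - 2)) < Real.log (1 / (σ₀ * ‖v‖)))
    (hstep : η * ‖v‖ ^ 2 ≤ κ⁻¹) :
    (σ₀ * ‖v‖ / 2) ^ (-(q - 2)) < (⌊firstStageLength q m v η σ₀⌋₊ : ℝ)
      * (η * q * ‖v‖ ^ 2 * c₀ / (4 * m) * ((q - 2) / q)) := by
  have hv0 : 0 < ‖v‖ := norm_pos_iff.2 hv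
  have hx0 : 0 < σ₀ * ‖v‖ := mul_pos hσ₀ hv0
  have hq0 : 0 < q := by linarith
  have hq2 : 0 < q - 2 := by linarith
  have hm0 : (0 : ℝ) < m := by exact_mod_cast hm
  have hF : 2 ≤ firstStageLength q m v η σ₀ :=
    le_trans (by rw [le_div_iff₀ hq0]; exact hκ)
      (firstStageLength_ge hq hv hσ₀ hη hm (by linarith : 0 < κ) hx1 hlog1 hstep)
  have hfloor : firstStageLength q m v η σ₀ / 2 ≤ (⌊firstStageLength q m v η σ₀⌋₊ : ℝ) := by
    have := Nat.lt_floor_add_one (firstStageLength q m v η σ₀)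
    linarith
  rw [firstStageLength_eq m v η hσ₀ hv] at *
  set x := σ₀ * ‖v‖ with hx
  have h24 : (2 : ℝ) ^ (q - 2) ≤ 4 ^ (q - 1) :=
    (Real.rpow_le_rpow (by norm_num) (by norm_num) hq2.le).trans
      (Real.rpow_le_rpow_of_exponent_le (by norm_num) (by linarith))
  have hxp : 0 < x ^ (q - 2) := by positivity
  calc (x / 2) ^ (-(q - 2)) = 2 ^ (q - 2) / x ^ (q - 2) := by
        rw [Real.rpow_neg (by positivity), Real.div_rpow hx0.le (by norm_num), inv_div]
    _ ≤ 4 ^ (q - 1) / x ^ (q - 2) := by gcongr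
    _ = 8 * q / (c₀ * (q - 2)) * (4 ^ (q - 1) / x ^ (q - 2) * (c₀ * (q - 2) / (8 * q))) := by
        field_simp
    _ < Real.log (1 / x) * (4 ^ (q - 1) / x ^ (q - 2) * (c₀ * (q - 2) / (8 * q))) := by
        gcongr
    _ = Real.log (1 / x) * 4 ^ (q - 1) * m / (η * q * x ^ (q - 2) * ‖v‖ ^ 2) / 2
        * (η * q * ‖v‖ ^ 2 * c₀ / (4 * m) * ((q - 2) / q)) := by
        field_simp
        norm_num
    _ ≤ _ := by gcongr

/-- In the regime of the conditions every failure probability is a small power of `1 / d`. -/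
lemma failure_probability_le {p₀ κ₀ : ℝ} (hd : 3 ≤ d) (hmd : m ≤ d) (hnd : n ≤ d)
    (hℓ : 1 ≤ Real.log d) (hn : 32 * Real.log d ≤ n) (hm : 4 * Real.log d ≤ p₀ * m)
    (hκd : 2 * Real.log d ≤ κ₀ * d) :
    ((2 * m + 2 * m * n + n * n + n * d + n + 1 + n) * (2 * Real.exp (-((4 * Real.log d) ^ 2 / 2)))
      + n * Real.exp (-(2 * κ₀ * d)) + 2 * Real.exp (-(n / 8)) + 2 * Real.exp (-(p₀ * m)) : ℝ)
      ≤ 1 / d := by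
  have hd3 : (3 : ℝ) ≤ d := by exact_mod_cast hd
  have hm' : (m : ℝ) ≤ d := by exact_mod_cast hmd
  have hn' : (n : ℝ) ≤ d := by exact_mod_cast hnd
  have hd0 : (0 : ℝ) < d := by linarith
  have hm0 : (0 : ℝ) ≤ m := Nat.cast_nonneg m
  have hn0 : (0 : ℝ) ≤ n := Nat.cast_nonneg n
  have hexp : ∀ k : ℕ, Real.exp (-(k * Real.log d)) = 1 / (d : ℝ) ^ k := by
    intro k
    rw [Real.exp_neg, Real.exp_nat_mul, Real.exp_log hd0, one_div]
  have e1 : Real.exp (-((4 * Real.log d) ^ 2 / 2)) ≤ 1 / (d : ℝ) ^ 8 := by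
    rw [← hexp 8, Real.exp_le_exp]
    push_cast
    nlinarith
  have e2 : Real.exp (-(2 * κ₀ * d)) ≤ 1 / (d : ℝ) ^ 4 := by
    rw [← hexp 4, Real.exp_le_exp]
    push_cast
    linarith
  have e3 : Real.exp (-((n : ℝ) / 8)) ≤ 1 / (d : ℝ) ^ 4 := by
    rw [← hexp 4, Real.exp_le_exp]
    push_cast
    linarith
  have e4 : Real.exp (-(p₀ * m)) ≤ 1 / (d : ℝ) ^ 4 := by
    rw [← hexp 4, Real.exp_le_exp]
    push_cast
    linarith
  have hcoef : (2 * m + 2 * m * n + n * n + n * d + n + 1 + n : ℝ) ≤ 9 * (d : ℝ) ^ 2 := by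
    have h1 : (m : ℝ) * n ≤ d * d := by gcongr
    have h2 : (n : ℝ) * n ≤ d * d := by gcongr
    have h3 : (n : ℝ) * d ≤ d * d := by gcongr
    nlinarith
  calc _ ≤ 9 * (d : ℝ) ^ 2 * (2 * (1 / (d : ℝ) ^ 8)) + d * (1 / (d : ℝ) ^ 4)
      + 2 * (1 / (d : ℝ) ^ 4) + 2 * (1 / (d : ℝ) ^ 4) := by gcongr
    _ = (18 / (d : ℝ) ^ 5 + 1 / (d : ℝ) ^ 2 + 4 / (d : ℝ) ^ 3) * (1 / d) := by
        field_simp; ring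
    _ ≤ (18 / 3 ^ 5 + 1 / 3 ^ 2 + 4 / 3 ^ 3) * (1 / d) := by gcongr
    _ ≤ 1 * (1 / d) := by gcongr; norm_num
    _ = _ := one_mul _

/-- The conclusion of the theorem from explicit bounds on the polylogarithmic factors. Here `B`
bounds those in the privacy noise and in the number of iterations, and `κ` is the one in the
conditions; `κ₀` and `p₀` are the absolute constants of
`exists_outcomeLaw_not_wellBehaved_le`. -/
theorem exists_firstStage_le_outcomeLaw {p₀ κ₀ B σξ ε c : ℝ} {T : ℕ} (hq : 2 < q)
    (hκ₀ : 0 < κ₀) (hp₀ : 0 < p₀)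
    (hprob : ∀ (N : ℕ) (σz L : ℝ), 0 ≤ σz → 0 ≤ L → L ^ 2 ≤ κ₀ * d → v ≠ 0 →
      outcomeLaw d m n v σ₀ σξ σz
        {ω | ¬ WellBehaved L (√κ₀) (L * (η * σz * √(N : ℝ))) η σ₀ σξ N v ω}
        ≤ ENNReal.ofReal ((2 * m + 2 * m * n + n * n + n * d + n + 1 + n) *
          (2 * Real.exp (-(L ^ 2 / 2))) + n * Real.exp (-(2 * κ₀ * d))
          + 2 * Real.exp (-(n / 8)) + 2 * Real.exp (-(p₀ * m))))
    (hε : 0 < ε) (hη : 0 < η) (hσ₀ : 0 < σ₀) (hσξ : 0 < σξ)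
    (hcond : SignalLearningCondition q κ d m n v ε η σ₀ σξ)
    (hsnr : κ ≤ min (SNR v σξ * (n * ε)) (SNR v σξ ^ q * n))
    (hB : 1 ≤ B) (hc0 : 0 ≤ c) (hc : c ≤ B)
    (hT : (T : ℝ) ≤ B * (m * n * ε * σ₀ / (η * (‖v‖ + noiseNorm d σξ))))
    (hκ256 : 256 ≤ κ) (h256 : 256 * Real.log d ^ 2 ≤ κ) (hκ₀κ : 17 * Real.log d ^ 2 ≤ κ₀ * κ)
    (h4 : 4 * Real.log d ≤ p₀ * κ) (hκB : 8 * Real.log d * B ^ 2 * 2 ^ q ≤ κ)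
    (hκ3 : q * 3 ^ q ≤ κ)
    (hexp : Real.exp (8 * q / (lossSlope (3 ^ q + 1) * (q - 2)) + 1) ≤ κ) :
    ∃ T₁ : ℕ, (T₁ : ℝ) ≤ firstStageLength q m v η σ₀ ∧
      1 - 1 / (d : ℝ) ≤
        (outcomeLaw d m n v σ₀ σξ (privacyNoiseStd m n T v σξ ε c)).real
          {ω | ∃ coef : Coefficients m n,
            IsDecomposition q η v ω coef ∧
            (∀ coef' : Coefficients m n, IsDecomposition q η v ω coef' → coef' = coef) ∧
            (∀ j : Bool, 2 ≤ ⨆ r : Fin m, coef.Γ j r T₁) ∧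
            (∀ (j : Bool) (r : Fin m) (i : Fin n) (t : ℕ), t ≤ T₁ →
              |coef.Φ j r i t| ≤ σ₀ * σξ * √(d : ℝ))} := by
  have hq0 : 0 < q := by linarith
  have hκ1 : 1 ≤ κ := by linarith
  have hκ0 : 0 < κ := by linarith
  have hc₀0 : 0 < lossSlope (3 ^ q + 1) := by unfold lossSlope; positivity
  set c₀ := lossSlope (3 ^ q + 1) with hc₀
  have hnκ := hcond.sample_size
  have hmκ := hcond.width
  have hn1 : (1 : ℝ) ≤ n := hκ1.trans hnκ
  have hm1 : (1 : ℝ) ≤ m := hκ1.trans hmκ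
  have hn : 0 < n := by exact_mod_cast lt_of_lt_of_le one_pos hn1
  have hm : 0 < m := by exact_mod_cast lt_of_lt_of_le one_pos hm1
  have hdκ : κ * ((m : ℝ) ^ 2 * (n : ℝ) ^ 4) ≤ d := by
    refine le_trans ?_ hcond.dim
    have h1 : (m : ℝ) ^ 2 ≤ (m : ℝ) ^ max 2 (4 / (q - 2)) := by
      rw [← Real.rpow_natCast]
      exact Real.rpow_le_rpow_of_exponent_le hm1 (by exact_mod_cast le_max_left _ _)
    have h2 : (n : ℝ) ^ 4 ≤ (n : ℝ) ^ max 4 ((2 * q - 2) / (q - 2)) := by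
      rw [← Real.rpow_natCast]
      exact Real.rpow_le_rpow_of_exponent_le hn1 (by exact_mod_cast le_max_left _ _)
    gcongr
  have hdκn : κ * (n : ℝ) ^ 2 ≤ d := by
    refine le_trans ?_ hdκ
    have h1 : 1 ≤ (m : ℝ) ^ 2 := one_le_pow₀ hm1
    have h2 : (n : ℝ) ^ 2 ≤ (n : ℝ) ^ 4 := pow_le_pow_right₀ hn1 (by norm_num)
    calc κ * (n : ℝ) ^ 2 = κ * (1 * (n : ℝ) ^ 2) := by ring
      _ ≤ _ := by gcongr
  have hκd : κ ≤ d := le_trans (le_mul_of_one_le_right hκ0.le (one_le_pow₀ hn1)) hdκn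
  have hd3 : (3 : ℝ) ≤ d := by linarith
  have hd0 : (0 : ℝ) < d := by linarith
  have hℓ : 1 ≤ Real.log d := by
    rw [Real.le_log_iff_exp_le hd0]
    linarith [Real.exp_one_lt_d9]
  set ℓ := Real.log d with hℓdef
  have hℓℓ : ℓ ≤ ℓ ^ 2 := le_self_pow₀ hℓ two_ne_zero
  -- the noise level and the signal do not vanish
  set X := noiseNorm d σξ with hXdef
  have hX : 0 < X := by rw [hXdef]; unfold noiseNorm; positivity
  have hv : v ≠ 0 := by
    rintro rfl
    have := hsnr.trans (min_le_left _ _)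
    rw [SNR, norm_zero, zero_div, zero_mul] at this
    linarith
  have hv0 : 0 < ‖v‖ := norm_pos_iff.2 hv
  have hx0 : 0 < σ₀ * ‖v‖ := mul_pos hσ₀ hv0
  have he0 : 0 < (n : ℝ) * ε := by positivity
  have hxκ : σ₀ * ‖v‖ ≤ κ⁻¹ := by
    have h1 : σ₀ ≤ κ⁻¹ * ((n : ℝ) ^ (-(1 / (2 * q))) * ‖v‖⁻¹) :=
      hcond.init_upper.trans (by
        gcongr
        exact (min_le_right _ _).trans (min_le_left _ _))
    have h2 : (n : ℝ) ^ (-(1 / (2 * q))) ≤ 1 :=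
      Real.rpow_le_one_of_one_le_of_nonpos hn1 (by
        rw [neg_nonpos]; positivity)
    calc σ₀ * ‖v‖ ≤ κ⁻¹ * ((n : ℝ) ^ (-(1 / (2 * q))) * ‖v‖⁻¹) * ‖v‖ := by gcongr
      _ = κ⁻¹ * (n : ℝ) ^ (-(1 / (2 * q))) := by field_simp
      _ ≤ κ⁻¹ * 1 := by gcongr
      _ = κ⁻¹ := mul_one _
  have hyκ : σ₀ * X ≤ κ⁻¹ * ((n : ℝ) * ε) ^ (-((q + 1) / q)) := by
    have h1 : σ₀ ≤ κ⁻¹ * (((n : ℝ) * ε) ^ (-((q + 1) / q)) * X⁻¹) :=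
      hcond.init_upper.trans (by
        gcongr
        exact (min_le_right _ _).trans (min_le_right _ _))
    calc σ₀ * X ≤ κ⁻¹ * (((n : ℝ) * ε) ^ (-((q + 1) / q)) * X⁻¹) * X := by gcongr
      _ = _ := by field_simp
  have hlow : κ * ((n : ℝ) * ε) ^ (-(1 / q)) ≤ σ₀ * ‖v‖ := by
    calc κ * ((n : ℝ) * ε) ^ (-(1 / q))
        = κ * (((n : ℝ) * ε) ^ (-(1 / q)) * ‖v‖⁻¹) * ‖v‖ := by field_simp
      _ ≤ σ₀ * ‖v‖ := by gcongr; exact hcond.init_lower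
  obtain ⟨he1, hxe, hyx, hxinv⟩ := regime_bounds hq hκ1 he0 hx0 hlow hxκ hyκ
  have hκinv : κ⁻¹ ≤ 1 := inv_le_one_of_one_le₀ hκ1
  have hx1 : σ₀ * ‖v‖ ≤ 1 := hxκ.trans hκinv
  have hyx1 : σ₀ * X ≤ σ₀ * ‖v‖ := by
    refine le_trans (le_mul_of_one_le_right (by positivity) ?_) hyx
    exact one_le_mul_of_one_le_of_one_le (one_le_pow₀ hκ1) he1
  have hlogκ : 8 * q / (c₀ * (q - 2)) + 1 ≤ Real.log (1 / (σ₀ * ‖v‖)) := by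
    rw [Real.le_log_iff_exp_le (by positivity)]
    calc Real.exp (8 * q / (c₀ * (q - 2)) + 1) ≤ κ := hexp
      _ ≤ 1 / (σ₀ * ‖v‖) := by
        rw [le_div_iff₀ hx0]
        calc κ * (σ₀ * ‖v‖) ≤ κ * κ⁻¹ := by gcongr
          _ = 1 := mul_inv_cancel₀ hκ0.ne'
  have hstepv : η * ‖v‖ ^ 2 ≤ κ⁻¹ := by
    have h1 : η ≤ κ⁻¹ * (‖v‖ ^ 2)⁻¹ := hcond.step.trans (by gcongr; exact min_le_left _ _)
    calc η * ‖v‖ ^ 2 ≤ κ⁻¹ * (‖v‖ ^ 2)⁻¹ * ‖v‖ ^ 2 := by gcongr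
      _ = κ⁻¹ := by field_simp
  have h3q : (1 : ℝ) ≤ 3 ^ (q - 2) := Real.one_le_rpow (by norm_num) (by linarith)
  have h3q' : (3 : ℝ) ^ (q - 2) * 9 = 3 ^ q := by
    rw [show (9 : ℝ) = 3 ^ (2 : ℝ) by norm_num, ← Real.rpow_add (by norm_num)]
    norm_num
  have hq3 : q * 3 ^ (q - 2) * 9 ≤ κ := by rwa [mul_assoc, h3q']
  have hqq : q ≤ q * 3 ^ (q - 2) := le_mul_of_one_le_right hq0.le h3q
  have hqκ : 2 * q ≤ κ := by linarith
  have hE0 : 0 < 8 * q / (c₀ * (q - 2)) :=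
    div_pos (by linarith) (mul_pos hc₀0 (by linarith))
  have hlog1 : 1 ≤ Real.log (1 / (σ₀ * ‖v‖)) := by linarith
  have hF0 : 0 ≤ firstStageLength q m v η σ₀ :=
    le_trans (by positivity) (firstStageLength_ge hq hv hσ₀ hη hm hκ0 hx1 hlog1 hstepv)
  set N := ⌊firstStageLength q m v η σ₀⌋₊ with hN
  have hNF : (N : ℝ) ≤ firstStageLength q m v η σ₀ := Nat.floor_le hF0
  refine ⟨N, hNF, ?_⟩
  -- with this factor each Gaussian tail `exp (-L² / 2)` is at most `d ^ (-8)`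
  set L := 4 * ℓ with hL
  have hL1 : 1 ≤ L := by linarith
  have hLκ : 16 * L ^ 2 ≤ κ := by
    calc 16 * L ^ 2 = 256 * ℓ ^ 2 := by rw [hL]; ring
      _ ≤ κ := h256
  have hLL : L ≤ L ^ 2 := le_self_pow₀ hL1 two_ne_zero
  set σz := privacyNoiseStd m n T v σξ ε c with hσz
  have hσz0 : 0 ≤ σz := by rw [hσz]; unfold privacyNoiseStd; rw [← hXdef]; positivity
  have hρ : L * (η * σz * √(N : ℝ)) ≤ σ₀ / 2 := by
    refine privacy_noise_small hq hκ1 hv hσ₀ hη hX hm he0 (by linarith) hx1 hyx1 hxe hc0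
      hc hT hNF ?_ hB
    calc 2 * L * B ^ 2 * 2 ^ q = 8 * ℓ * B ^ 2 * 2 ^ q := by rw [hL]; ring
      _ ≤ κ := hκB
  have hcross : n * (L * σξ) < √κ₀ * noiseNorm d σξ := by
    have h1 : (n * L) ^ 2 < κ₀ * d := by
      calc (n * L) ^ 2 = (n : ℝ) ^ 2 * (16 * ℓ ^ 2) := by rw [hL]; ring
        _ < (n : ℝ) ^ 2 * (17 * ℓ ^ 2) := by gcongr; norm_num
        _ ≤ (n : ℝ) ^ 2 * (κ₀ * κ) := by gcongr
        _ = κ₀ * (κ * (n : ℝ) ^ 2) := by ring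
        _ ≤ κ₀ * d := by gcongr
    have h2 : n * L < √(κ₀ * d) := Real.lt_sqrt_of_sq_lt h1
    rw [Real.sqrt_mul hκ₀.le] at h2
    unfold noiseNorm
    calc n * (L * σξ) = n * L * σξ := by ring
      _ < √κ₀ * √(d : ℝ) * σξ := by gcongr
      _ = _ := by ring
  have hLd : L ^ 2 ≤ κ₀ * d := by
    calc L ^ 2 = 16 * ℓ ^ 2 := by rw [hL]; ring
      _ ≤ 17 * ℓ ^ 2 := by gcongr; norm_num
      _ ≤ κ₀ * κ := hκ₀κ
      _ ≤ κ₀ * d := by gcongr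
  have hsum := noise_memorization_small hq hκ1 hv hσ₀ hη hX hm hn hL1 hx1 he1 hxinv hyx hLκ hNF
  have hsmall : ∀ b : ℝ, 0 ≤ b → b ≤ κ → b * (σ₀ * ‖v‖) ≤ 1 := by
    intro b hb0 hb
    calc b * (σ₀ * ‖v‖) ≤ κ * κ⁻¹ := by gcongr
      _ = 1 := mul_inv_cancel₀ hκ0.ne'
  have hsmallv : 2 * L * (σ₀ * ‖v‖) ≤ 1 := hsmall _ (by linarith) (by linarith)
  have hsmallξ : 4 * L ^ 2 * (σ₀ * X) ≤ 1 :=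
    (mul_le_mul_of_nonneg_left hyx1 (by positivity)).trans
      (hsmall _ (by positivity) (by linarith [sq_nonneg L]))
  have hstep : η * q * ‖v‖ ^ 2 * c₀ / (4 * m) * 3 ^ (q - 2) ≤ 1 := by
    have hc1 : c₀ ≤ 1 := lossSlope_le_one _
    calc η * q * ‖v‖ ^ 2 * c₀ / (4 * m) * 3 ^ (q - 2)
        = η * ‖v‖ ^ 2 * (q * 3 ^ (q - 2)) * c₀ / (4 * m) := by ring
      _ ≤ κ⁻¹ * κ * 1 / 1 := by
          gcongr
          · linarith
          · linarith
      _ = 1 := by field_simp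
  have hlong := first_stage_long hq hv hσ₀ hη hm hqκ hx1 hlog1 hc₀0 (by linarith) hstepv
  -- outside an event of probability at most `1 / d` the deterministic analysis applies
  have := outcomeLaw_isProbabilityMeasure (m := m) (n := n) v σ₀ σξ σz
  set P := outcomeLaw d m n v σ₀ σξ σz with hP
  set S := {ω : Outcome d m n | ∃ coef : Coefficients m n,
              IsDecomposition q η v ω coef ∧
              (∀ coef' : Coefficients m n, IsDecomposition q η v ω coef' → coef' = coef) ∧
              (∀ j : Bool, 2 ≤ ⨆ r : Fin m, coef.Γ j r N) ∧
              (∀ (j : Bool) (r : Fin m) (i : Fin n) (t : ℕ), t ≤ N →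
                |coef.Φ j r i t| ≤ σ₀ * σξ * √(d : ℝ))} with hS
  have hgood : Sᶜ ⊆
      {ω | ¬ WellBehaved L (√κ₀) (L * (η * σz * √(N : ℝ))) η σ₀ σξ N v ω} := by
    intro ω hω hwb
    refine hω ⟨gradientCoefficients q η v ω, isDecomposition_gradientCoefficients ω hq hη hv,
      fun c' hc' => isDecomposition_unique hwb (by positivity) hcross hv
        (isDecomposition_gradientCoefficients ω hq hη hv) hc', fun j => ?_, fun j r i t ht => ?_⟩
    · exact two_le_iSup_Γ hwb hq hη hv hn hL1 hσ₀ hσξ hcross hρ hsum hsmallv hsmallξ hstep hlong j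
    · have h := abs_Φ_le hwb hq hη hv hL1 hσ₀ hσξ hcross hρ hsum ht j r i
      rw [mul_assoc]
      exact h
  have hfail := hprob N σz L hσz0 (by linarith) hLd hv
  have hle : P Sᶜ ≤ ENNReal.ofReal (1 / d) := by
    refine (measure_mono hgood).trans (hfail.trans (ENNReal.ofReal_le_ofReal ?_))
    have hd3' : 3 ≤ d := by exact_mod_cast hd3
    have hmd : m ≤ d := by
      have h : (m : ℝ) ≤ d := by
        refine le_trans ?_ hdκ
        have h1 : 1 ≤ (n : ℝ) ^ 4 := one_le_pow₀ hn1
        calc (m : ℝ) = 1 * (m * 1) := by ring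
          _ ≤ κ * ((m : ℝ) ^ 2 * (n : ℝ) ^ 4) := by gcongr; exact le_self_pow₀ hm1 two_ne_zero
      exact_mod_cast h
    have hnd : n ≤ d := by
      have h : (n : ℝ) ≤ d := by
        refine le_trans ?_ hdκn
        calc (n : ℝ) = 1 * n := by ring
          _ ≤ κ * (n : ℝ) ^ 2 := by gcongr; exact le_self_pow₀ hn1 two_ne_zero
      exact_mod_cast h
    refine failure_probability_le hd3' hmd hnd hℓ ?_ ?_ ?_
    · linarith
    · exact h4.trans (by gcongr)
    · calc 2 * ℓ ≤ 17 * ℓ ^ 2 := by linarith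
        _ ≤ κ₀ * κ := hκ₀κ
        _ ≤ κ₀ * d := by gcongr
  have hreal : P.real Sᶜ ≤ 1 / d := ENNReal.toReal_le_of_le_ofReal (by positivity) hle
  have hone : (1 : ℝ) ≤ P.real S + P.real Sᶜ := by
    have h := measureReal_union_le (μ := P) S Sᶜ
    rwa [Set.union_compl_self, probReal_univ] at h
  linarith

end Regime

end NoisyCNN

theorem theorem4p6 :
    -- absolute constants of the two `O(·)` in the conclusion
    ∃ C₁ C₂ : ℝ, 0 < C₁ ∧ 0 < C₂ ∧
    -- the polylogarithmic factor `A (log d)^a` is the `Õ(1)` in the privacy noise and in `T`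
    ∀ q : ℝ, 2 < q → ∀ (A : ℝ) (a : ℕ),
    -- the polylogarithmic factor `K (log d)^k` is the one in the conditions
    ∃ (K : ℝ) (k : ℕ), 0 < K ∧
    ∀ (d m n T : ℕ) (v : Vec d) (ε η σ₀ σξ c : ℝ),
      0 < ε → 0 < η → 0 < σ₀ → 0 < σξ →
      SignalLearningCondition q (K * Real.log d ^ k) d m n v ε η σ₀ σξ →
      K * Real.log d ^ k ≤ min (SNR v σξ * (n * ε)) (SNR v σξ ^ q * n) →
      0 ≤ c → c ≤ A * Real.log d ^ a →
      (T : ℝ) ≤ A * Real.log d ^ a * (m * n * ε * σ₀ / (η * (‖v‖ + noiseNorm d σξ))) →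
      ∃ T₁ : ℕ, (T₁ : ℝ) ≤ C₁ * firstStageLength q m v η σ₀ ∧
        1 - 1 / (d : ℝ) ≤
          (outcomeLaw d m n v σ₀ σξ (privacyNoiseStd m n T v σξ ε c)).real
            {ω | ∃ coef : Coefficients m n,
              IsDecomposition q η v ω coef ∧
              (∀ coef' : Coefficients m n, IsDecomposition q η v ω coef' → coef' = coef) ∧
              (∀ j : Bool, 2 ≤ ⨆ r : Fin m, coef.Γ j r T₁) ∧
              (∀ (j : Bool) (r : Fin m) (i : Fin n) (t : ℕ), t ≤ T₁ →
                |coef.Φ j r i t| ≤ C₂ * (σ₀ * σξ * √(d : ℝ)))} := by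
  obtain ⟨κ₀, p₀, hκ₀, hp₀, hprob⟩ := exists_outcomeLaw_not_wellBehaved_le
  refine ⟨1, 1, one_pos, one_pos, fun q hq A a => ?_⟩
  simp only [one_mul]
  obtain ⟨G, hG256, hGκ₀, hGp₀, hGA, hGq, hGexp⟩ : ∃ G : ℝ, 256 ≤ G ∧ 17 / κ₀ ≤ G ∧ 4 / p₀ ≤ G ∧
      8 * max 1 A ^ 2 * 2 ^ q ≤ G ∧ q * 3 ^ q ≤ G ∧
      Real.exp (8 * q / (lossSlope (3 ^ q + 1) * (q - 2)) + 1) ≤ G :=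
    ((((((Filter.eventually_ge_atTop _).and (Filter.eventually_ge_atTop _)).and
      (Filter.eventually_ge_atTop _)).and (Filter.eventually_ge_atTop _)).and
      (Filter.eventually_ge_atTop _)).and (Filter.eventually_ge_atTop _)).exists.imp
      fun G h => by tauto
  have hA1 : 1 ≤ max 1 A := le_max_left _ _
  have hl2 : 0 < Real.log 2 := Real.log_pos one_lt_two
  have hG0 : 0 < G := by linarith
  -- dividing by `(log 2) ^ k` makes the factor at least `G` for every `d ≥ 2`
  refine ⟨G / Real.log 2 ^ (2 * a + 2), 2 * a + 2, by positivity, ?_⟩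
  intro d m n T v ε η σ₀ σξ c hε hη hσ₀ hσξ hcond hsnr hc0 hc hT
  -- for `d ≤ 1` the factor vanishes and the bound on the step size is violated
  have hd2 : 2 ≤ d := by
    by_contra! hlt
    have hlog : Real.log d = 0 := by
      interval_cases d <;> simp
    have := hcond.step
    rw [hlog, zero_pow (by omega), mul_zero, inv_zero, zero_mul] at this
    linarith
  have hd2' : (2 : ℝ) ≤ d := by exact_mod_cast hd2
  have hℓ2 : Real.log 2 ≤ Real.log d := Real.log_le_log two_pos hd2'
  have hκG : G ≤ G / Real.log 2 ^ (2 * a + 2) * Real.log d ^ (2 * a + 2) := by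
    rw [div_mul_eq_mul_div, le_div_iff₀ (by positivity)]
    gcongr
  have hκℓ : G * Real.log d ^ (2 * a + 2)
      ≤ G / Real.log 2 ^ (2 * a + 2) * Real.log d ^ (2 * a + 2) := by
    gcongr
    rw [le_div_iff₀ (by positivity)]
    refine mul_le_of_le_one_right hG0.le (pow_le_one₀ hl2.le ?_)
    linarith [Real.log_two_lt_d9]
  generalize G / Real.log 2 ^ (2 * a + 2) * Real.log d ^ (2 * a + 2) = κ at *
  have hℓ : 1 ≤ Real.log d := by
    have hκ1 : 1 ≤ κ := by linarith
    have hd3 : κ ≤ d := by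
      refine le_trans (le_mul_of_one_le_right (by linarith) ?_) hcond.dim
      have hm1 : 1 ≤ (m : ℝ) := hκ1.trans hcond.width
      have hn1 : 1 ≤ (n : ℝ) := hκ1.trans hcond.sample_size
      exact one_le_mul_of_one_le_of_one_le
        (Real.one_le_rpow hm1 (le_max_of_le_left (by norm_num)))
        (Real.one_le_rpow hn1 (le_max_of_le_left (by norm_num)))
    rw [Real.le_log_iff_exp_le (by linarith)]
    linarith [Real.exp_one_lt_d9]
  have hκℓ2 : G * Real.log d ^ 2 ≤ κ :=
    le_trans (mul_le_mul_of_nonneg_left (pow_le_pow_right₀ hℓ (by omega)) hG0.le) hκℓ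
  have hℓℓ : Real.log d ≤ Real.log d ^ 2 := le_self_pow₀ hℓ two_ne_zero
  have hAB : A * Real.log d ^ a ≤ max 1 A * Real.log d ^ a :=
    mul_le_mul_of_nonneg_right (le_max_right _ _) (by positivity)
  have hX : 0 ≤ noiseNorm d σξ := by unfold noiseNorm; positivity
  refine exists_firstStage_le_outcomeLaw (B := max 1 A * Real.log d ^ a) hq hκ₀ hp₀
    (fun N σz L hσz hL hLd hv => hprob d m n N v σ₀ σξ σz η L hv hσ₀ hσξ.le hσz hη hL hLd)
    hε hη hσ₀ hσξ hcond hsnr (one_le_mul_of_one_le_of_one_le hA1 (one_le_pow₀ hℓ)) hc0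
    (hc.trans hAB) (hT.trans (mul_le_mul_of_nonneg_right hAB (by positivity)))
    (hG256.trans hκG) ?_ ?_ ?_ ?_ (hGq.trans hκG) (hGexp.trans hκG)
  · exact le_trans (by gcongr) hκℓ2
  · calc 17 * Real.log d ^ 2 = κ₀ * (17 / κ₀ * Real.log d ^ 2) := by field_simp
      _ ≤ κ₀ * (G * Real.log d ^ 2) := by gcongr
      _ ≤ κ₀ * κ := by gcongr
  · calc 4 * Real.log d = p₀ * (4 / p₀ * Real.log d) := by field_simp
      _ ≤ p₀ * (G * Real.log d ^ 2) := by gcongr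
      _ ≤ p₀ * κ := by gcongr
  · calc 8 * Real.log d * (max 1 A * Real.log d ^ a) ^ 2 * 2 ^ q
        = 8 * max 1 A ^ 2 * 2 ^ q * (Real.log d * Real.log d ^ (2 * a)) := by ring
      _ ≤ G * (Real.log d ^ 2 * Real.log d ^ (2 * a)) := by gcongr
      _ = G * Real.log d ^ (2 * a + 2) := by ring
      _ ≤ κ := hκℓ
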